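/- Let $Cl(W_B)$ be the complex Clifford algebra generated by the neutral fermions $\phi_n$ ($n\in\mathbb Z$), with basis $(\phi_n)$ of $W_B$ and $[\phi_m,\phi_n]_+=(-1)^m\delta_{m,-n}$. Let $\mathcal F_B=Cl(W_B)/Cl(W_B)\big(\sum_{n<0}\mathbb C\phi_n\big)$ and $\mathcal F_B^*=Cl(W_B)/\big(\sum_{n>0}\mathbb C\phi_n\big)Cl(W_B)$ be the right and left Fock spaces, with $|0\rangle$, $\langle 0|$ the classes of $1$, and let $\langle U|V\rangle$ be the pairing $\langle 0|a\cdot b|0\rangle=\langle 0|ab|0\rangle$ normalised by $\langle0|0\rangle=1$, $\langle0|\phi_0|0\rangle=0$. Put $\langle 1|=2^{1/2}\langle 0|\phi_0$, $\phi(z)=\sum_{i\in\mathbb Z}\phi_iz^i$ and, for $n$ odd, $H_n=\frac12\sum_{i\in\mathbb Z}(-1)^{i+1}\phi_i\phi_{-i-n}$ (a locally finite sum on either Fock space). For $t=(t_1,t_3,t_5,\dots)$ put $H_+(t)=\sum_{k\ge1\text{ odd}}t_kH_k$ and $\xi(t,z)=\sum_{k\ge1\text{ odd}}t_kz^k$,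 and let $H_+[z^{-1}]$ be $H_+(t)$ at $t_k=\frac{2}{k}z^{-k}$. Let $$\sigma_B:\mathcal F_B\to\mathbb C[w,t_1,t_3,\dots]/\langle w^2-1\rangle,\qquad \sigma_B(|U\rangle)=\sum_{i=0}^1w^i\langle i|e^{H_+(t)}|U\rangle$$ be the boson–fermion correspondence of type $B_\infty$, and let $X_B(z)=e^{\xi(t,z)}e^{-\xi(\tilde\partial,z^{-1})}$ with $\tilde\partial=(2\partial_{t_1},\frac23\partial_{t_3},\frac25\partial_{t_5},\dots)$. Then, as an identity of formal series in $z,z^{-1}$, for every $|U\rangle\in\mathcal F_B$, $$\sigma_B(\phi(z)|U\rangle)=2^{-1/2}\,w\,X_B(z)\,\sigma_B(|U\rangle).$$ Moreover, as identities of formal series in $z,z^{-1}$ with coefficients in $\mathcal F_B^*$, $$\langle1|e^{-H_+[z^{-1}]}=2^{1/2}\langle0|\phi(z),\qquad \langle0|e^{-H_+[z^{-1}]}=2^{1/2}\langle1|\phi(z).$$ -/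

import Mathlib

namespace BInf

noncomputable section

/-! ### Neutral fermions -/

/-- The complex vector space `W_B` with basis `(φ_n)`, `n ∈ ℤ`. -/
abbrev WB := ℤ →₀ ℂ

/-- The bilinear form giving the anticommutator: `(φ_m, φ_n) ↦ (-1)^m δ_{m,-n}`. -/
def acForm : LinearMap.BilinForm ℂ WB :=
  Finsupp.linearCombination ℂ fun m : ℤ => ((-1 : ℂ) ^ m) • Finsupp.lapply (R := ℂ) (-m)

/-- The quadratic form with `v * v = Q(v)`, i.e. `[v, w]_+ = acForm v w`. -/
def fermQ : QuadraticForm ℂ WB :=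
  LinearMap.BilinMap.toQuadraticMap ((1 / 2 : ℂ) • acForm)

/-- The Clifford algebra `Cl(W_B)`. -/
abbrev ClB := CliffordAlgebra fermQ

/-- The neutral fermion `φ_n`. -/
def phi (n : ℤ) : ClB := CliffordAlgebra.ι fermQ (Finsupp.single n 1)

theorem acForm_single (m n : ℤ) :
    acForm (Finsupp.single m 1) (Finsupp.single n 1) = if m = -n then (-1 : ℂ) ^ m else 0 := by
  by_cases h : m = -n
  · subst h; simp [acForm]
  · have : n ≠ -m := by omega
    simp [acForm, h, this]

theorem acForm_symm (v w : WB) : acForm v w = acForm w v := by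
  have : acForm = acForm.flip := by
    ext m n
    change acForm (Finsupp.single m 1) (Finsupp.single n 1) =
      acForm (Finsupp.single n 1) (Finsupp.single m 1)
    rw [acForm_single, acForm_single]
    by_cases h : m = -n
    · subst h; simp [zpow_neg, ← inv_zpow]
    · have : n ≠ -m := by omega
      simp [h, this]
  conv_lhs => rw [this]
  rfl

theorem ι_anticomm (v w : WB) :
    CliffordAlgebra.ι fermQ v * CliffordAlgebra.ι fermQ w +
      CliffordAlgebra.ι fermQ w * CliffordAlgebra.ι fermQ v =
      algebraMap ℂ ClB (acForm v w) := by
  rw [CliffordAlgebra.ι_mul_ι_add_swap]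
  congr 1
  simp only [QuadraticMap.polar, fermQ, LinearMap.BilinMap.toQuadraticMap_apply,
    LinearMap.smul_apply, map_add, LinearMap.add_apply, smul_eq_mul]
  rw [acForm_symm w v]; ring

/-- The defining relation `[φ_m, φ_n]_+ = (-1)^m δ_{m,-n}`. -/
theorem phi_anticomm (m n : ℤ) :
    phi m * phi n + phi n * phi m =
      algebraMap ℂ ClB (if m = -n then (-1 : ℂ) ^ m else 0) := by
  rw [phi, phi, ι_anticomm, acForm_single]

/-- The right Fock space: the quotient of `Cl(W_B)` by the left ideal generated by
`φ_n`, `n < 0`. It is a left `Cl(W_B)`-module. -/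
def FockR : Type := ClB ⧸ Submodule.span ClB {a : ClB | ∃ n : ℤ, n < 0 ∧ a = phi n}

instance : AddCommGroup FockR :=
  inferInstanceAs (AddCommGroup (ClB ⧸ Submodule.span ClB {a : ClB | ∃ n : ℤ, n < 0 ∧ a = phi n}))

instance : Module ClB FockR :=
  inferInstanceAs
    (Module ClB (ClB ⧸ Submodule.span ClB {a : ClB | ∃ n : ℤ, n < 0 ∧ a = phi n}))

instance : Module ℂ FockR :=
  inferInstanceAs (Module ℂ (ClB ⧸ Submodule.span ClB {a : ClB | ∃ n : ℤ, n < 0 ∧ a = phi n}))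

instance : IsScalarTower ℂ ClB FockR :=
  inferInstanceAs
    (IsScalarTower ℂ ClB (ClB ⧸ Submodule.span ClB {a : ClB | ∃ n : ℤ, n < 0 ∧ a = phi n}))

/-- The left Fock space: the quotient of `Cl(W_B)` by the right ideal generated by
`φ_n`, `n > 0`. It is a right `Cl(W_B)`-module. -/
def FockL : Type := ClB ⧸ Submodule.span ClBᵐᵒᵖ {a : ClB | ∃ n : ℤ, 0 < n ∧ a = phi n}

instance : AddCommGroup FockL :=
  inferInstanceAs
    (AddCommGroup (ClB ⧸ Submodule.span ClBᵐᵒᵖ {a : ClB | ∃ n : ℤ, 0 < n ∧ a = phi n}))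

instance : Module ClBᵐᵒᵖ FockL :=
  inferInstanceAs
    (Module ClBᵐᵒᵖ (ClB ⧸ Submodule.span ClBᵐᵒᵖ {a : ClB | ∃ n : ℤ, 0 < n ∧ a = phi n}))

instance : Module ℂ FockL :=
  inferInstanceAs (Module ℂ (ClB ⧸ Submodule.span ClBᵐᵒᵖ {a : ClB | ∃ n : ℤ, 0 < n ∧ a = phi n}))

instance : IsScalarTower ℂ ClBᵐᵒᵖ FockL :=
  inferInstanceAs
    (IsScalarTower ℂ ClBᵐᵒᵖ (ClB ⧸ Submodule.span ClBᵐᵒᵖ {a : ClB | ∃ n : ℤ, 0 < n ∧ a = phi n}))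

/-- The class `a|0⟩`. -/
def ketOf (a : ClB) : FockR := Submodule.Quotient.mk a

/-- The class `⟨0|a`. -/
def braOf (a : ClB) : FockL := Submodule.Quotient.mk a

/-- `⟨0|`. -/
def bra0 : FockL := braOf 1

/-- `⟨1| = 2^{1/2} ⟨0|φ_0`. -/
def bra1 : FockL := ((Real.sqrt 2 : ℝ) : ℂ) • braOf (phi 0)

/-- The operator `|U⟩ ↦ φ_n|U⟩`. -/
def ketPhi (n : ℤ) : Module.End ℂ FockR := Algebra.lsmul ℂ ℂ FockR (phi n)

/-- The operator `⟨U| ↦ ⟨U|φ_n`. -/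
def braPhi (n : ℤ) : Module.End ℂ FockL := Algebra.lsmul ℂ ℂ FockL (MulOpposite.op (phi n))

theorem ketPhi_ketOf (n : ℤ) (a : ClB) : ketPhi n (ketOf a) = ketOf (phi n * a) := rfl

theorem braPhi_braOf (n : ℤ) (a : ClB) : braPhi n (braOf a) = braOf (a * phi n) := rfl

theorem ketOf_eq_zero (n : ℤ) (hn : n < 0) (a : ClB) : ketOf (a * phi n) = 0 :=
  (Submodule.Quotient.mk_eq_zero _).2
    (Submodule.smul_mem _ a (Submodule.subset_span ⟨n, hn, rfl⟩))

theorem braOf_eq_zero (n : ℤ) (hn : 0 < n) (a : ClB) : braOf (phi n * a) = 0 :=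
  (Submodule.Quotient.mk_eq_zero _).2
    (Submodule.smul_mem _ (MulOpposite.op a) (Submodule.subset_span ⟨n, hn, rfl⟩))

/-! ### Vacuum expectation value and pairing -/

/-- The two-point function `⟨φ_m φ_n⟩`, as a bilinear form on `W_B`: it is
`(-1)^m δ_{m,-n}` for `n > 0`, `δ_{m,0}/2` for `n = 0`, and `0` for `n < 0`. -/
def twoPoint : LinearMap.BilinForm ℂ WB :=
  Finsupp.linearCombination ℂ fun m : ℤ =>
    (if m < 0 then (-1 : ℂ) ^ m else if m = 0 then 1 / 2 else 0) • Finsupp.lapply (R := ℂ) (-m)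

theorem twoPoint_add_flip : twoPoint + twoPoint.flip = acForm := by
  ext m n
  change twoPoint (Finsupp.single m 1) (Finsupp.single n 1) +
    twoPoint (Finsupp.single n 1) (Finsupp.single m 1) =
      acForm (Finsupp.single m 1) (Finsupp.single n 1)
  simp only [twoPoint, acForm, Finsupp.linearCombination_single, one_smul,
    LinearMap.smul_apply, Finsupp.lapply_apply, Finsupp.single_apply, smul_eq_mul]
  by_cases h : n = -m
  · subst h
    rcases lt_trichotomy m 0 with hm | hm | hm
    · have h1 : ¬ (0 < m) := by omega
      have h2 : m ≠ 0 := by omega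
      simp [hm, h1, h2]
    · subst hm; norm_num
    · have h1 : ¬ (m < 0) := by omega
      have h2 : m ≠ 0 := by omega
      simp [hm, h1, h2, zpow_neg, ← inv_zpow]
  · have : m ≠ -n := by omega
    simp [h, this]

theorem twoPoint_toQuadraticMap :
    LinearMap.BilinMap.toQuadraticMap (-twoPoint) = 0 - fermQ := by
  ext v
  have h : twoPoint v v + twoPoint v v = acForm v v := by
    rw [← twoPoint_add_flip]; rfl
  simp only [LinearMap.BilinMap.toQuadraticMap_apply, LinearMap.neg_apply, fermQ,
    sub_apply, zero_apply, LinearMap.smul_apply, smul_eq_mul, ← h]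
  ring

/-- The normal ordering (Wick) map from the Clifford algebra to the exterior algebra. -/
def wick : ClB →ₗ[ℂ] ExteriorAlgebra ℂ WB :=
  CliffordAlgebra.changeForm twoPoint_toQuadraticMap

/-- The vacuum expectation value `a ↦ ⟨0|a|0⟩`: the scalar part of the normally ordered form.
By `vev_one`, `vev_phi_zero`, `vev_phi_mul` and `vev_mul_phi` it is the linear form that takes
the value `1` at `1` and `0` at `φ_0` and descends to the left and right Fock spaces; these
properties determine it. -/
def vev : ClB →ₗ[ℂ] ℂ :=
  (ExteriorAlgebra.algebraMapInv (R := ℂ) (M := WB)).toLinearMap ∘ₗ wick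

theorem vev_one : vev 1 = 1 := by
  simp [vev, wick, CliffordAlgebra.changeForm_one]

theorem vev_phi_zero : vev (phi 0) = 0 := by
  simp only [vev, wick, phi, LinearMap.comp_apply, CliffordAlgebra.changeForm_ι]
  exact CliffordAlgebra.lift_ι_apply _ _ _

theorem algebraMapInv_ι_mul (v : WB) (x : ExteriorAlgebra ℂ WB) :
    ExteriorAlgebra.algebraMapInv (CliffordAlgebra.ι 0 v * x : ExteriorAlgebra ℂ WB) = 0 := by
  rw [map_mul]
  have : ExteriorAlgebra.algebraMapInv (CliffordAlgebra.ι 0 v : ExteriorAlgebra ℂ WB) = 0 :=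
    CliffordAlgebra.lift_ι_apply _ _ _
  rw [this, zero_mul]

theorem algebraMapInv_mul_ι (v : WB) (x : ExteriorAlgebra ℂ WB) :
    ExteriorAlgebra.algebraMapInv (x * CliffordAlgebra.ι 0 v : ExteriorAlgebra ℂ WB) = 0 := by
  rw [map_mul]
  have : ExteriorAlgebra.algebraMapInv (CliffordAlgebra.ι 0 v : ExteriorAlgebra ℂ WB) = 0 :=
    CliffordAlgebra.lift_ι_apply _ _ _
  rw [this, mul_zero]

theorem vev_phi_mul (n : ℤ) (hn : 0 < n) (a : ClB) : vev (phi n * a) = 0 := by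
  have h : twoPoint (Finsupp.single n 1) = 0 := by
    have h1 : ¬ (n < 0) := by omega
    have h2 : n ≠ 0 := by omega
    simp [twoPoint, h1, h2]
  simp only [vev, wick, phi, LinearMap.comp_apply, CliffordAlgebra.changeForm_ι_mul,
    LinearMap.neg_apply, h, neg_zero, map_zero, LinearMap.zero_apply, sub_zero]
  exact algebraMapInv_ι_mul _ _

theorem contractLeft_mul_ι_of_eq_zero {q : QuadraticForm ℂ WB} (d : Module.Dual ℂ WB) (v : WB)
    (h : d v = 0) (x : CliffordAlgebra q) :
    CliffordAlgebra.contractLeft d (x * CliffordAlgebra.ι q v) =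
      CliffordAlgebra.contractLeft d x * CliffordAlgebra.ι q v := by
  induction x using CliffordAlgebra.left_induction with
  | algebraMap r =>
    rw [CliffordAlgebra.contractLeft_algebraMap_mul, CliffordAlgebra.contractLeft_ι, h]
    simp
  | add x y hx hy => rw [add_mul, map_add, hx, hy, map_add, add_mul]
  | ι_mul x u hx =>
    rw [mul_assoc, CliffordAlgebra.contractLeft_ι_mul, hx, CliffordAlgebra.contractLeft_ι_mul,
      sub_mul, smul_mul_assoc, mul_assoc]

theorem wick_mul_phi (n : ℤ) (hn : n < 0) (a : ClB) :
    wick (a * phi n) = wick a * CliffordAlgebra.ι 0 (Finsupp.single n 1) := by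
  have h : ∀ u : WB, twoPoint u (Finsupp.single n 1) = 0 := by
    intro u
    have : twoPoint.flip (Finsupp.single n 1) = 0 := by
      ext m
      change twoPoint (Finsupp.single m 1) (Finsupp.single n 1) = 0
      simp only [twoPoint, Finsupp.linearCombination_single, one_smul,
        LinearMap.smul_apply, Finsupp.lapply_apply, Finsupp.single_apply, smul_eq_mul]
      by_cases hm : n = -m
      · have h1 : ¬ (m < 0) := by omega
        have h2 : m ≠ 0 := by omega
        simp [h1, h2]
      · simp [hm]
    exact DFunLike.congr_fun this u
  induction a using CliffordAlgebra.left_induction with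
  | algebraMap r =>
    simp only [wick, phi, ← Algebra.smul_def, map_smul, CliffordAlgebra.changeForm_ι,
      CliffordAlgebra.changeForm_algebraMap]
  | add x y hx hy => rw [add_mul, map_add, hx, hy, map_add, add_mul]
  | ι_mul x u hx =>
    have h' : (-twoPoint) u (Finsupp.single n 1) = 0 := by
      rw [LinearMap.neg_apply, LinearMap.neg_apply, h, neg_zero]
    rw [mul_assoc]
    simp only [wick, CliffordAlgebra.changeForm_ι_mul] at hx ⊢
    rw [hx, contractLeft_mul_ι_of_eq_zero _ _ h', sub_mul, mul_assoc]

theorem vev_mul_phi (n : ℤ) (hn : n < 0) (a : ClB) : vev (a * phi n) = 0 := by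
  rw [vev, LinearMap.comp_apply, wick_mul_phi n hn]
  exact algebraMapInv_mul_ι _ _

theorem vev_eq_zero_of_mem_right {b : ClB}
    (hb : b ∈ Submodule.span ClB {a : ClB | ∃ n : ℤ, n < 0 ∧ a = phi n}) (a : ClB) :
    vev (a * b) = 0 := by
  induction hb using Submodule.span_induction generalizing a with
  | mem x hx => obtain ⟨n, hn, rfl⟩ := hx; exact vev_mul_phi n hn a
  | zero => simp
  | add x y _ _ hx hy => rw [mul_add, map_add, hx, hy, add_zero]
  | smul c x _ hx => rw [smul_eq_mul, ← mul_assoc]; exact hx _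

theorem vev_eq_zero_of_mem_left {b : ClB}
    (hb : b ∈ Submodule.span ClBᵐᵒᵖ {a : ClB | ∃ n : ℤ, 0 < n ∧ a = phi n}) (a : ClB) :
    vev (b * a) = 0 := by
  induction hb using Submodule.span_induction generalizing a with
  | mem x hx => obtain ⟨n, hn, rfl⟩ := hx; exact vev_phi_mul n hn a
  | zero => simp
  | add x y _ _ hx hy => rw [add_mul, map_add, hx, hy, add_zero]
  | smul c x _ hx =>
    rw [← MulOpposite.op_unop c, op_smul_eq_mul, mul_assoc]; exact hx _

/-- `|V⟩ ↦ ⟨0|a|V⟩`. -/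
def braPair (a : ClB) : FockR →ₗ[ℂ] ℂ :=
  ((Submodule.span ClB {a : ClB | ∃ n : ℤ, n < 0 ∧ a = phi n}).restrictScalars ℂ).liftQ
    (vev ∘ₗ LinearMap.mulLeft ℂ a) (fun _ hb => vev_eq_zero_of_mem_right hb a) ∘ₗ
  (Submodule.Quotient.restrictScalarsEquiv ℂ
    (Submodule.span ClB {a : ClB | ∃ n : ℤ, n < 0 ∧ a = phi n})).symm.toLinearMap

theorem braPair_ketOf (a b : ClB) : braPair a (ketOf b) = vev (a * b) := rfl

/-- `a ↦ ⟨0|a`, as linear forms on `FockR`. -/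
def braPairLin : ClB →ₗ[ℂ] FockR →ₗ[ℂ] ℂ where
  toFun := braPair
  map_add' a a' := LinearMap.ext fun v => by
    obtain ⟨b, rfl⟩ := Submodule.Quotient.mk_surjective _ v
    change vev ((a + a') * b) = vev (a * b) + vev (a' * b)
    rw [add_mul, map_add]
  map_smul' c a := LinearMap.ext fun v => by
    obtain ⟨b, rfl⟩ := Submodule.Quotient.mk_surjective _ v
    change vev ((c • a) * b) = c • vev (a * b)
    rw [smul_mul_assoc, map_smul]

theorem braPairLin_eq_zero {a : ClB}
    (ha : a ∈ Submodule.span ClBᵐᵒᵖ {a : ClB | ∃ n : ℤ, 0 < n ∧ a = phi n}) :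
    braPairLin a = 0 := LinearMap.ext fun v => by
  obtain ⟨b, rfl⟩ := Submodule.Quotient.mk_surjective _ v
  exact vev_eq_zero_of_mem_left ha b

/-- The pairing `⟨U|V⟩` of the left and right Fock spaces: `⟨0|a` and `b|0⟩` pair to
`⟨0|ab|0⟩`. -/
def pairing : FockL →ₗ[ℂ] FockR →ₗ[ℂ] ℂ :=
  ((Submodule.span ClBᵐᵒᵖ {a : ClB | ∃ n : ℤ, 0 < n ∧ a = phi n}).restrictScalars ℂ).liftQ
    braPairLin (fun _ ha => braPairLin_eq_zero ha) ∘ₗ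
  (Submodule.Quotient.restrictScalarsEquiv ℂ
    (Submodule.span ClBᵐᵒᵖ {a : ClB | ∃ n : ℤ, 0 < n ∧ a = phi n})).symm.toLinearMap

theorem pairing_braOf_ketOf (a b : ClB) : pairing (braOf a) (ketOf b) = vev (a * b) := rfl

/-! ### Locally finite sums of operators and the current modes `H_n` -/

/-- The sum of a family of linear maps of which only finitely many are nonzero on each vector. -/
def locSum {ι M N : Type*} [AddCommGroup M] [Module ℂ M] [AddCommGroup N] [Module ℂ N]
    (T : ι → M →ₗ[ℂ] N) (h : ∀ u, (Function.support fun i => T i u).Finite) : M →ₗ[ℂ] N where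
  toFun u := ∑ᶠ i, T i u
  map_add' u v := by
    rw [← finsum_add_distrib (h u) (h v)]
    exact finsum_congr fun i => map_add _ _ _
  map_smul' c u := by
    rw [RingHom.id_apply, smul_finsum' c (h u)]
    exact finsum_congr fun i => map_smul _ _ _

/-- The subspace of `FockR` spanned by the vectors `φ_{n_1} ⋯ φ_{n_k}|0⟩` with all `n_i ≥ 0` and
`n_1 + ⋯ + n_k ≤ d`. -/
def ketFilt (d : ℤ) : Submodule ℂ FockR :=
  Submodule.span ℂ {u | ∃ l : List ℤ, (∀ n ∈ l, 0 ≤ n) ∧ l.sum ≤ d ∧ u = ketOf (l.map phi).prod}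

theorem ketFilt_neg {d : ℤ} (hd : d < 0) : ketFilt d = ⊥ := by
  rw [ketFilt, Submodule.span_eq_bot]
  rintro u ⟨l, hl, hs, -⟩
  exact absurd (List.sum_nonneg hl) (by omega)

theorem ketFilt_mono {d e : ℤ} (h : d ≤ e) : ketFilt d ≤ ketFilt e := by
  apply Submodule.span_mono
  rintro u ⟨l, hl, hs, rfl⟩
  exact ⟨l, hl, hs.trans h, rfl⟩

theorem ketPhi_mem_of_nonneg {n : ℤ} (hn : 0 ≤ n) {d : ℤ} {u : FockR} (hu : u ∈ ketFilt d) :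
    ketPhi n u ∈ ketFilt (d + n) := by
  induction hu using Submodule.span_induction with
  | mem x hx =>
    obtain ⟨l, hl, hs, rfl⟩ := hx
    refine Submodule.subset_span ⟨n :: l, ?_, ?_, ?_⟩
    · intro m hm
      rcases List.mem_cons.1 hm with rfl | hm
      · exact hn
      · exact hl _ hm
    · rw [List.sum_cons]; omega
    · rw [ketPhi_ketOf, List.map_cons, List.prod_cons]
  | zero => simp
  | add x y _ _ hx hy => rw [map_add]; exact add_mem hx hy
  | smul c x _ hx => rw [map_smul]; exact Submodule.smul_mem _ _ hx

theorem ketPhi_swap (m n : ℤ) (u : FockR) :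
    ketPhi m (ketPhi n u) =
      (if m = -n then (-1 : ℂ) ^ m else 0) • u - ketPhi n (ketPhi m u) := by
  obtain ⟨a, rfl⟩ := Submodule.Quotient.mk_surjective _ u
  change ketOf (phi m * (phi n * a)) = (_ : ℂ) • ketOf a - ketOf (phi n * (phi m * a))
  have h : phi m * (phi n * a) =
      (if m = -n then (-1 : ℂ) ^ m else 0) • a - phi n * (phi m * a) := by
    rw [Algebra.smul_def, ← phi_anticomm]; noncomm_ring
  rw [h]; rfl

theorem braPhi_swap (m n : ℤ) (u : FockL) :
    braPhi n (braPhi m u) =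
      (if m = -n then (-1 : ℂ) ^ m else 0) • u - braPhi m (braPhi n u) := by
  obtain ⟨a, rfl⟩ := Submodule.Quotient.mk_surjective _ u
  change braOf (a * phi m * phi n) = (_ : ℂ) • braOf a - braOf (a * phi n * phi m)
  have h : a * phi m * phi n =
      (if m = -n then (-1 : ℂ) ^ m else 0) • a - a * phi n * phi m := by
    rw [Algebra.smul_def, Algebra.commutes, ← phi_anticomm]; noncomm_ring
  rw [h]; rfl

theorem ketPhi_mem (n : ℤ) {d : ℤ} {u : FockR} (hu : u ∈ ketFilt d) :
    ketPhi n u ∈ ketFilt (d + n) := by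
  rcases le_or_gt 0 n with hn | hn
  · exact ketPhi_mem_of_nonneg hn hu
  induction hu using Submodule.span_induction with
  | zero => simp
  | add x y _ _ hx hy => rw [map_add]; exact add_mem hx hy
  | smul c x _ hx => rw [map_smul]; exact Submodule.smul_mem _ _ hx
  | mem x hx =>
    obtain ⟨l, hl, hs, rfl⟩ := hx
    refine ketFilt_mono (show l.sum + n ≤ d + n by omega) ?_
    clear hs d
    induction l with
    | nil =>
      have : ketPhi n (ketOf (([] : List ℤ).map phi).prod) = 0 := by
        have := ketOf_eq_zero n hn 1
        simpa [ketPhi_ketOf] using this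
      rw [this]; exact zero_mem _
    | cons m l ih =>
      have hm : 0 ≤ m := hl m (by simp)
      have hl' : ∀ k ∈ l, 0 ≤ k := fun k hk => hl k (by simp [hk])
      rw [List.map_cons, List.prod_cons, ← ketPhi_ketOf, ketPhi_swap, List.sum_cons]
      refine sub_mem ?_ ?_
      · by_cases h : n = -m
        · refine Submodule.smul_mem _ _ (Submodule.subset_span ⟨l, hl', by omega, rfl⟩)
        · rw [if_neg h, zero_smul]; exact zero_mem _
      · exact ketFilt_mono (by omega) (ketPhi_mem_of_nonneg hm (ih hl'))

theorem exists_mem_ketFilt (u : FockR) : ∃ d, u ∈ ketFilt d := by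
  obtain ⟨a, rfl⟩ := Submodule.Quotient.mk_surjective _ u
  change ∃ d, ketOf a ∈ ketFilt d
  induction a using CliffordAlgebra.left_induction with
  | algebraMap r =>
    refine ⟨0, ?_⟩
    have : ketOf (algebraMap ℂ ClB r) = r • ketOf 1 := by
      rw [Algebra.algebraMap_eq_smul_one]; rfl
    rw [this]
    exact Submodule.smul_mem _ _ (Submodule.subset_span ⟨[], by simp, by simp, by simp⟩)
  | add x y hx hy =>
    obtain ⟨d, hd⟩ := hx
    obtain ⟨e, he⟩ := hy
    exact ⟨max d e, add_mem (ketFilt_mono (le_max_left _ _) hd)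
      (ketFilt_mono (le_max_right _ _) he)⟩
  | ι_mul x v hx =>
    induction v using Finsupp.induction_linear with
    | zero => exact ⟨0, by rw [map_zero, zero_mul]; exact zero_mem (ketFilt 0)⟩
    | add f g hf hg =>
      obtain ⟨d, hd⟩ := hf
      obtain ⟨e, he⟩ := hg
      refine ⟨max d e, ?_⟩
      rw [map_add, add_mul]
      exact add_mem (ketFilt_mono (le_max_left _ _) hd) (ketFilt_mono (le_max_right _ _) he)
    | single n c =>
      obtain ⟨d, hd⟩ := hx
      refine ⟨d + n, ?_⟩
      have : ketOf (CliffordAlgebra.ι fermQ (Finsupp.single n c) * x) =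
          c • ketPhi n (ketOf x) := by
        have h : Finsupp.single n c = c • Finsupp.single n (1 : ℂ) := by simp
        rw [h, map_smul, smul_mul_assoc]; rfl
      rw [this]
      exact Submodule.smul_mem _ _ (ketPhi_mem n hd)

theorem exists_ketPhi_eq_zero (u : FockR) : ∃ N : ℤ, ∀ n < N, ketPhi n u = 0 := by
  obtain ⟨d, hd⟩ := exists_mem_ketFilt u
  refine ⟨-d, fun n hn => ?_⟩
  have := ketPhi_mem n hd
  rwa [ketFilt_neg (by omega), Submodule.mem_bot] at this

theorem exists_braPhi_eq_zero (u : FockL) : ∃ N : ℤ, ∀ n > N, braPhi n u = 0 := by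
  obtain ⟨a, rfl⟩ := Submodule.Quotient.mk_surjective _ u
  change ∃ N : ℤ, ∀ n > N, braPhi n (braOf a) = 0
  induction a using CliffordAlgebra.right_induction with
  | algebraMap r =>
    refine ⟨0, fun n hn => ?_⟩
    rw [braPhi_braOf, Algebra.commutes, braOf_eq_zero n hn]
  | add x y hx hy =>
    obtain ⟨d, hd⟩ := hx
    obtain ⟨e, he⟩ := hy
    refine ⟨max d e, fun n hn => ?_⟩
    have : braOf (x + y) = braOf x + braOf y := rfl
    rw [this, map_add, hd n (lt_of_le_of_lt (le_max_left _ _) hn),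
      he n (lt_of_le_of_lt (le_max_right _ _) hn), add_zero]
  | mul_ι v x hx =>
    obtain ⟨d, hd⟩ := hx
    induction v using Finsupp.induction_linear with
    | zero => exact ⟨0, fun n _ => by rw [map_zero, mul_zero]; exact map_zero (braPhi n)⟩
    | add f g hf hg =>
      obtain ⟨d, hd⟩ := hf
      obtain ⟨e, he⟩ := hg
      refine ⟨max d e, fun n hn => ?_⟩
      rw [map_add, mul_add]
      have : braOf (x * CliffordAlgebra.ι fermQ f + x * CliffordAlgebra.ι fermQ g) =
        braOf (x * CliffordAlgebra.ι fermQ f) + braOf (x * CliffordAlgebra.ι fermQ g) := rfl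
      rw [this, map_add, hd n (lt_of_le_of_lt (le_max_left _ _) hn),
        he n (lt_of_le_of_lt (le_max_right _ _) hn), add_zero]
    | single k c =>
      refine ⟨max d (-k), fun n hn => ?_⟩
      have : braOf (x * CliffordAlgebra.ι fermQ (Finsupp.single k c)) =
          c • braPhi k (braOf x) := by
        have h : Finsupp.single k c = c • Finsupp.single k (1 : ℂ) := by simp
        rw [h, map_smul, mul_smul_comm]; rfl
      have h1 : k ≠ -n := by have := lt_of_le_of_lt (le_max_right _ _) hn; omega
      rw [this, map_smul, braPhi_swap, hd n (lt_of_le_of_lt (le_max_left _ _) hn)]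
      simp [h1]

/-- The `i`-th term of `H_n` on `FockR`: `(-1)^{i+1} φ_i φ_{-i-n}`. -/
def ketHTerm (n i : ℤ) : Module.End ℂ FockR := ((-1 : ℂ) ^ (i + 1)) • (ketPhi i ∘ₗ ketPhi (-i - n))

theorem ketHTerm_finite (n : ℤ) (hn : n ≠ 0) (u : FockR) :
    (Function.support fun i => ketHTerm n i u).Finite := by
  obtain ⟨N, hN⟩ := exists_ketPhi_eq_zero u
  refine (Set.finite_Icc N (-N - n)).subset fun i hi => ?_
  by_contra hc
  apply hi
  simp only [ketHTerm, LinearMap.smul_apply, LinearMap.comp_apply]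
  rcases lt_or_ge i N with h | h
  · have h1 : i ≠ -(-i - n) := by omega
    rw [ketPhi_swap, hN i h, if_neg h1]; simp
  · have h1 : -i - n < N := by
      by_contra h2; exact hc ⟨h, by omega⟩
    rw [hN _ h1]; simp

/-- The operator `H_n = (1/2) ∑_{i ∈ ℤ} (-1)^{i+1} φ_i φ_{-i-n}` (`n ≠ 0`) on `FockR`. -/
def ketH (n : ℤ) (hn : n ≠ 0) : Module.End ℂ FockR :=
  (1 / 2 : ℂ) • locSum (ketHTerm n) (ketHTerm_finite n hn)

/-- The `i`-th term of `H_n` acting from the right: `⟨U| ↦ (-1)^{i+1} ⟨U|φ_i φ_{-i-n}`. -/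
def braHTerm (n i : ℤ) : Module.End ℂ FockL := ((-1 : ℂ) ^ (i + 1)) • (braPhi (-i - n) ∘ₗ braPhi i)

theorem braHTerm_finite (n : ℤ) (hn : n ≠ 0) (u : FockL) :
    (Function.support fun i => braHTerm n i u).Finite := by
  obtain ⟨N, hN⟩ := exists_braPhi_eq_zero u
  refine (Set.finite_Icc (-N - n) N).subset fun i hi => ?_
  by_contra hc
  apply hi
  simp only [braHTerm, LinearMap.smul_apply, LinearMap.comp_apply]
  rcases lt_or_ge N i with h | h
  · rw [hN i h]; simp
  · have h1 : -i - n > N := by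
      by_contra h2; exact hc ⟨by omega, h⟩
    have h2 : i ≠ -(-i - n) := by omega
    rw [braPhi_swap, hN _ h1, if_neg h2]; simp

/-- The operator `⟨U| ↦ ⟨U|H_n` (`n ≠ 0`) on `FockL`. -/
def braH (n : ℤ) (hn : n ≠ 0) : Module.End ℂ FockL :=
  (1 / 2 : ℂ) • locSum (braHTerm n) (braHTerm_finite n hn)

/-! ### Exponentials of formal power series -/

/-- `e^A = ∑_m A^m / m!` for a formal power series `A` without constant term, with coefficients in
a possibly noncommutative `ℂ`-algebra. Only the terms `m ≤ |n|` contribute to the coefficient of a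
monomial of degree `|n|`. -/
def expSeries {σ R : Type*} [Ring R] [Algebra ℂ R] (A : MvPowerSeries σ R) : MvPowerSeries σ R :=
  fun n => ∑ m ∈ Finset.range (n.degree + 1), ((m.factorial : ℂ)⁻¹) • MvPowerSeries.coeff n (A ^ m)

/-- An operator lowers a filtration by `k`. -/
def Lowers {M : Type*} [AddCommGroup M] [Module ℂ M] (V : ℤ → Submodule ℂ M) (k : ℕ)
    (T : Module.End ℂ M) : Prop := ∀ d, ∀ u ∈ V d, T u ∈ V (d - k)

theorem lowers_coeff_pow {σ M : Type*} [AddCommGroup M] [Module ℂ M] (V : ℤ → Submodule ℂ M)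
    (wt : (σ →₀ ℕ) →+ ℕ) (A : MvPowerSeries σ (Module.End ℂ M))
    (hA : ∀ n, Lowers V (wt n) (MvPowerSeries.coeff n A)) (m : ℕ) (n : σ →₀ ℕ) :
    Lowers V (wt n) (MvPowerSeries.coeff n (A ^ m)) := by
  classical
  induction m generalizing n with
  | zero =>
    intro d u hu
    rw [pow_zero, MvPowerSeries.coeff_one]
    split_ifs with h
    · subst h; simpa using hu
    · simp
  | succ m ih =>
    intro d u hu
    rw [pow_succ, MvPowerSeries.coeff_mul, LinearMap.sum_apply]
    refine sum_mem fun p hp => ?_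
    have hp' := Finset.HasAntidiagonal.mem_antidiagonal.1 hp
    have := ih p.1 _ _ (hA p.2 d u hu)
    rw [← hp', map_add]
    push_cast
    rwa [add_comm, ← sub_sub]

theorem lowers_coeff_expSeries {σ M : Type*} [AddCommGroup M] [Module ℂ M]
    (V : ℤ → Submodule ℂ M) (wt : (σ →₀ ℕ) →+ ℕ) (A : MvPowerSeries σ (Module.End ℂ M))
    (hA : ∀ n, Lowers V (wt n) (MvPowerSeries.coeff n A)) (n : σ →₀ ℕ) :
    Lowers V (wt n) (MvPowerSeries.coeff n (expSeries A)) := by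
  intro d u hu
  change (∑ m ∈ Finset.range (n.degree + 1),
    ((m.factorial : ℂ)⁻¹) • MvPowerSeries.coeff n (A ^ m)) u ∈ _
  rw [LinearMap.sum_apply]
  exact sum_mem fun m _ => Submodule.smul_mem _ _ (lowers_coeff_pow V wt A hA m n d u hu)

/-! ### The current operator and the bosonic space -/

/-- Positive odd integers, the index set of the times `t_1, t_3, t_5, …`. -/
abbrev OddPos := {k : ℕ // Odd k}

theorem oddPos_ne_zero (k : OddPos) : ((k : ℕ) : ℤ) ≠ 0 := by
  have := k.2.pos; omega

/-- `H_+(t) = ∑_{k ≥ 1 odd} t_k H_k` on `FockR`, a formal power series in the `t_k` whose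
coefficients are operators. -/
def currentPlus : MvPowerSeries OddPos (Module.End ℂ FockR) := fun n =>
  ∑ k ∈ n.support, if n = Finsupp.single k 1 then ketH k (oddPos_ne_zero k) else 0

theorem coeff_currentPlus_single (k : OddPos) :
    MvPowerSeries.coeff (Finsupp.single k 1) currentPlus = ketH k (oddPos_ne_zero k) := by
  change (∑ j ∈ (Finsupp.single k 1 : OddPos →₀ ℕ).support,
    if Finsupp.single k 1 = Finsupp.single j 1 then ketH j (oddPos_ne_zero j) else 0) = _
  rw [show (Finsupp.single k 1 : OddPos →₀ ℕ).support = {k} from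
    Finsupp.support_single k one_ne_zero, Finset.sum_singleton, if_pos rfl]

theorem coeff_currentPlus_of_ne (n : OddPos →₀ ℕ) (h : ¬ ∃ k : OddPos, n = Finsupp.single k 1) :
    MvPowerSeries.coeff n currentPlus = 0 :=
  Finset.sum_eq_zero fun k _ => if_neg fun hk => h ⟨k, hk⟩

/-- The weight `∑ k α_k` of the monomial `t^α`. -/
def timeWt : (OddPos →₀ ℕ) →+ ℕ := Finsupp.weight (fun k : OddPos => (k : ℕ))

theorem lowers_ketH (k : OddPos) : Lowers ketFilt k (ketH k (oddPos_ne_zero k)) := by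
  intro d u hu
  refine Submodule.smul_mem _ _ ?_
  refine finsum_induction (· ∈ ketFilt (d - (k : ℕ))) (zero_mem _) (fun _ _ => add_mem) fun i => ?_
  refine Submodule.smul_mem _ _ ?_
  have := ketPhi_mem i (ketPhi_mem (-i - (k : ℕ)) hu)
  rwa [show d + (-i - ((k : ℕ) : ℤ)) + i = d - ((k : ℕ) : ℤ) by ring] at this

theorem lowers_currentPlus (n : OddPos →₀ ℕ) :
    Lowers ketFilt (timeWt n) (MvPowerSeries.coeff n currentPlus) := by
  by_cases h : ∃ k : OddPos, n = Finsupp.single k 1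
  · obtain ⟨k, rfl⟩ := h
    rw [coeff_currentPlus_single]
    have : timeWt (Finsupp.single k 1) = k := by simp [timeWt, Finsupp.weight_single]
    rw [this]
    exact lowers_ketH k
  · intro d u hu
    rw [coeff_currentPlus_of_ne n h]; simp

theorem finite_timeWt_le (d : ℕ) : {n : OddPos →₀ ℕ | timeWt n ≤ d}.Finite := by
  classical
  have hfin : {k : OddPos | (k : ℕ) ≤ d}.Finite :=
    (Set.finite_Iic d).preimage Subtype.val_injective.injOn
  refine (Set.finite_Iic (∑ k ∈ hfin.toFinset, Finsupp.single k d)).subset fun n hn => ?_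
  have key : ∀ k : OddPos, n k * (k : ℕ) ≤ d := fun k => by
    have h1 : timeWt n = n.sum fun k c => c * (k : ℕ) := by
      simp [timeWt, Finsupp.weight_apply]
    have hn' : timeWt n ≤ d := hn
    by_cases hk : k ∈ n.support
    · rw [h1, Finsupp.sum] at hn'
      exact (Finset.single_le_sum (f := fun k : OddPos => n k * (k : ℕ))
        (fun _ _ => Nat.zero_le _) hk).trans hn'
    · rw [Finsupp.notMem_support_iff.1 hk]; simp
  intro k
  rw [Finsupp.finsetSum_apply]
  by_cases hk : n k = 0
  · rw [hk]; exact Nat.zero_le _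
  have hkd : (k : ℕ) ≤ d := (Nat.le_mul_of_pos_left _ (Nat.pos_of_ne_zero hk)).trans (key k)
  have hnd : n k ≤ d := (Nat.le_mul_of_pos_right _ k.2.pos).trans (key k)
  refine hnd.trans ?_
  have := Finset.single_le_sum (f := fun j => (Finsupp.single j d : OddPos →₀ ℕ) k)
    (fun _ _ => Nat.zero_le _) (hfin.mem_toFinset.2 hkd)
  simpa using this

/-- The term of `⟨U|e^{H_+(t)}|V⟩` of multidegree `n` in `t`, as a linear map in `|V⟩`. -/
def corrTerm (u : FockL) (n : OddPos →₀ ℕ) : FockR →ₗ[ℂ] MvPolynomial OddPos ℂ :=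
  MvPolynomial.monomial n ∘ₗ pairing u ∘ₗ MvPowerSeries.coeff n (expSeries currentPlus)

theorem corrTerm_finite (u : FockL) (v : FockR) :
    (Function.support fun n => corrTerm u n v).Finite := by
  obtain ⟨d, hd⟩ := exists_mem_ketFilt v
  refine (finite_timeWt_le d.toNat).subset fun n hn => ?_
  by_contra hc
  apply hn
  have hc' : d.toNat < timeWt n := not_le.1 hc
  have h := lowers_coeff_expSeries ketFilt timeWt currentPlus lowers_currentPlus n d v hd
  rw [ketFilt_neg (by omega), Submodule.mem_bot] at h
  simp only [corrTerm, LinearMap.comp_apply, h, map_zero]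

/-- `|V⟩ ↦ ⟨U|e^{H_+(t)}|V⟩ ∈ ℂ[t_1, t_3, …]`. -/
def corr (u : FockL) : FockR →ₗ[ℂ] MvPolynomial OddPos ℂ :=
  locSum (corrTerm u) (corrTerm_finite u)

/-- `ℂ[w, t_1, t_3, …]`: the variable `none` is `w` and the variable `some k` is `t_k`. -/
abbrev BosonPoly := MvPolynomial (Option OddPos) ℂ

/-- The ideal `⟨w² - 1⟩`. -/
def wIdeal : Ideal BosonPoly := Ideal.span {MvPolynomial.X none ^ 2 - 1}

/-- The bosonic space `ℂ[w, t_1, t_3, …]/⟨w² - 1⟩`. -/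
abbrev Boson := BosonPoly ⧸ wIdeal

/-- `w`. -/
def bosonW : Boson := Ideal.Quotient.mk wIdeal (MvPolynomial.X none)

/-- `t_k`. -/
def bosonT (k : OddPos) : Boson := Ideal.Quotient.mk wIdeal (MvPolynomial.X (some k))

/-- The inclusion of `ℂ[t_1, t_3, …]`. -/
def bosonIncl : MvPolynomial OddPos ℂ →ₐ[ℂ] Boson := MvPolynomial.aeval bosonT

/-- The boson–fermion correspondence of type `B_∞`:
`|U⟩ ↦ ⟨0|e^{H_+(t)}|U⟩ + w ⟨1|e^{H_+(t)}|U⟩`. -/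
def sigmaB : FockR →ₗ[ℂ] Boson :=
  bosonIncl.toLinearMap ∘ₗ corr bra0 +
    LinearMap.mulLeft ℂ bosonW ∘ₗ bosonIncl.toLinearMap ∘ₗ corr bra1

/-! ### The vertex operator -/

theorem pderiv_mem_wIdeal (k : OddPos) {f : BosonPoly} (hf : f ∈ wIdeal) :
    MvPolynomial.pderiv (some k) f ∈ wIdeal := by
  obtain ⟨g, rfl⟩ := Ideal.mem_span_singleton.1 hf
  have h : MvPolynomial.pderiv (some k) (MvPolynomial.X none ^ 2 - 1 : BosonPoly) = 0 := by
    rw [map_sub, Derivation.leibniz_pow, MvPolynomial.pderiv_X_of_ne (by simp)]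
    simp
  rw [Derivation.leibniz, h, smul_zero, add_zero, smul_eq_mul]
  exact Ideal.mul_mem_right _ _ (Ideal.subset_span rfl)

/-- `∂/∂t_k` on `ℂ[w, t_1, t_3, …]/⟨w² - 1⟩`. -/
def bosonD (k : OddPos) : Module.End ℂ Boson :=
  (wIdeal.restrictScalars ℂ).mapQ (wIdeal.restrictScalars ℂ)
    (MvPolynomial.pderiv (some k)).toLinearMap fun _ hf => pderiv_mem_wIdeal k hf

theorem bosonD_mk (k : OddPos) (f : BosonPoly) :
    bosonD k (Ideal.Quotient.mk wIdeal f) =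
      Ideal.Quotient.mk wIdeal (MvPolynomial.pderiv (some k) f) := rfl

/-- `ξ(t, z) = ∑_{k ≥ 1 odd} t_k z^k`, a power series in `z`. -/
def xiTime : PowerSeries Boson :=
  PowerSeries.mk fun n => if h : Odd n then bosonT ⟨n, h⟩ else 0

/-- `ξ(∂̃, u) = ∑_{k ≥ 1 odd} (2/k) ∂_{t_k} u^k`, a power series in `u = z⁻¹`. -/
def xiDeriv : PowerSeries (Module.End ℂ Boson) :=
  PowerSeries.mk fun n => if h : Odd n then (2 / n : ℂ) • bosonD ⟨n, h⟩ else 0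

/-- The weight of a monomial in `w, t_1, t_3, …`, where `w` has weight `0` and `t_k` weight `k`. -/
def bosonWt : (Option OddPos →₀ ℕ) →+ ℕ :=
  Finsupp.weight (fun o : Option OddPos => o.elim 0 (fun k => (k : ℕ)))

/-- The span of the monomials of weight at most `d`. -/
def bosonFilt (d : ℤ) : Submodule ℂ Boson :=
  Submodule.span ℂ {f | ∃ n, (bosonWt n : ℤ) ≤ d ∧
    f = Ideal.Quotient.mk wIdeal (MvPolynomial.monomial n 1)}

theorem bosonFilt_neg {d : ℤ} (hd : d < 0) : bosonFilt d = ⊥ := by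
  rw [bosonFilt, Submodule.span_eq_bot]
  rintro u ⟨n, hs, -⟩
  omega

theorem bosonFilt_mono {d e : ℤ} (h : d ≤ e) : bosonFilt d ≤ bosonFilt e := by
  apply Submodule.span_mono
  rintro u ⟨n, hs, rfl⟩
  exact ⟨n, hs.trans h, rfl⟩

theorem mk_monomial_eq (n : Option OddPos →₀ ℕ) (c : ℂ) :
    Ideal.Quotient.mk wIdeal (MvPolynomial.monomial n c) =
      c • Ideal.Quotient.mk wIdeal (MvPolynomial.monomial n 1) := by
  have : MvPolynomial.monomial n c = c • (MvPolynomial.monomial n 1 : BosonPoly) := by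
    rw [MvPolynomial.smul_monomial, smul_eq_mul, mul_one]
  rw [this]; rfl

theorem exists_mem_bosonFilt (f : Boson) : ∃ d, f ∈ bosonFilt d := by
  obtain ⟨p, rfl⟩ := Ideal.Quotient.mk_surjective f
  induction p using MvPolynomial.induction_on' with
  | monomial n c =>
    refine ⟨bosonWt n, ?_⟩
    rw [mk_monomial_eq]
    exact Submodule.smul_mem _ _ (Submodule.subset_span ⟨n, le_rfl, rfl⟩)
  | add p q hp hq =>
    obtain ⟨d, hd⟩ := hp
    obtain ⟨e, he⟩ := hq
    refine ⟨max d e, ?_⟩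
    rw [map_add]
    exact add_mem (bosonFilt_mono (le_max_left _ _) hd) (bosonFilt_mono (le_max_right _ _) he)

theorem lowers_bosonD (k : OddPos) : Lowers bosonFilt k (bosonD k) := by
  intro d u hu
  induction hu using Submodule.span_induction with
  | zero => simp
  | add x y _ _ hx hy => rw [map_add]; exact add_mem hx hy
  | smul c x _ hx => rw [map_smul]; exact Submodule.smul_mem _ _ hx
  | mem x hx =>
    obtain ⟨n, hn, rfl⟩ := hx
    rw [bosonD_mk, MvPolynomial.pderiv_monomial, mk_monomial_eq]
    by_cases h : n (some k) = 0
    · simp [h]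
    refine Submodule.smul_mem _ _ (Submodule.subset_span ⟨_, ?_, rfl⟩)
    have h1 : n - Finsupp.single (some k) 1 + Finsupp.single (some k) 1 = n :=
      tsub_add_cancel_of_le (Finsupp.single_le_iff.2 (Nat.one_le_iff_ne_zero.2 h))
    have h2 : bosonWt (Finsupp.single (some k) 1) = k := by
      simp [bosonWt, Finsupp.weight_single]
    have h3 := congrArg bosonWt h1
    rw [map_add, h2] at h3
    omega

/-- The weight on exponents of a power series in one variable. -/
def unitWt : (Unit →₀ ℕ) →+ ℕ := Finsupp.applyAddHom ()

theorem lowers_xiDeriv (n : Unit →₀ ℕ) :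
    Lowers bosonFilt (unitWt n) (MvPowerSeries.coeff n (-xiDeriv : PowerSeries _)) := by
  intro d u hu
  obtain ⟨j, rfl⟩ : ∃ j, n = Finsupp.single () j := ⟨n (), by ext; simp⟩
  have h1 : unitWt (Finsupp.single () j) = j := by simp [unitWt]
  have h2 : MvPowerSeries.coeff (Finsupp.single () j) (-xiDeriv : PowerSeries _) =
      -(if h : Odd j then (2 / j : ℂ) • bosonD ⟨j, h⟩ else 0) := by
    have : PowerSeries.coeff j (-xiDeriv) = -PowerSeries.coeff j xiDeriv := map_neg _ _
    rw [xiDeriv, PowerSeries.coeff_mk] at this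
    exact this
  rw [h1, h2]
  split_ifs with h
  · exact neg_mem (Submodule.smul_mem _ _ (lowers_bosonD ⟨j, h⟩ d u hu))
  · simp

/-- The coefficient of `z^m` in `X_B(z) = e^{ξ(t,z)} e^{-ξ(∂̃,z⁻¹)}` is the sum, over `j ≥ 0` with
`m + j ≥ 0`, of (coefficient of `z^{m+j}` in `e^{ξ(t,z)}`) times (coefficient of `z^{-j}` in
`e^{-ξ(∂̃,z⁻¹)}`); this is the `j`-th term. -/
def vertexTerm (m : ℤ) (j : ℕ) : Module.End ℂ Boson :=
  if 0 ≤ m + j then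
    LinearMap.mulLeft ℂ (PowerSeries.coeff (m + j).toNat (expSeries xiTime)) ∘ₗ
      PowerSeries.coeff j (expSeries (-xiDeriv))
  else 0

theorem vertexTerm_finite (m : ℤ) (f : Boson) :
    (Function.support fun j => vertexTerm m j f).Finite := by
  obtain ⟨d, hd⟩ := exists_mem_bosonFilt f
  refine (Set.finite_Iic d.toNat).subset fun j hj => ?_
  by_contra hc
  apply hj
  have hc' : d.toNat < j := not_le.1 hc
  have h := lowers_coeff_expSeries bosonFilt unitWt _ lowers_xiDeriv (Finsupp.single () j) d f hd
  have h1 : unitWt (Finsupp.single () j) = j := by simp [unitWt]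
  rw [h1, bosonFilt_neg (by omega), Submodule.mem_bot] at h
  have h2 : PowerSeries.coeff j (expSeries (-xiDeriv)) f = 0 := h
  simp only [vertexTerm]
  split_ifs
  · rw [LinearMap.comp_apply, h2, map_zero]
  · rfl

/-- The coefficient of `z^m` in the vertex operator `X_B(z) = e^{ξ(t,z)} e^{-ξ(∂̃,z⁻¹)}`. -/
def vertexB (m : ℤ) : Module.End ℂ Boson := locSum (vertexTerm m) (vertexTerm_finite m)

/-! ### Formal series in `z` and the statement's two sides -/

/-- Formal series `∑_{m ∈ ℤ} a_m z^m`, given by their coefficients. -/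
abbrev ZSeries (M : Type*) := ℤ → M

/-- `φ(z)|U⟩ = ∑_m φ_m|U⟩ z^m`. -/
def phiKet (v : FockR) : ZSeries FockR := fun m => ketPhi m v

/-- `⟨U|φ(z) = ∑_m ⟨U|φ_m z^m`. -/
def braPhiZ (u : FockL) : ZSeries FockL := fun m => braPhi m u

/-- `X_B(z) f`. -/
def vertexZ (f : Boson) : ZSeries Boson := fun m => vertexB m f

/-- `H_+[u] = ∑_{k ≥ 1 odd} (2u^k/k) H_k`, acting on `FockL` from the right, as a power series
in `u`. -/
def currentMiwa : PowerSeries (Module.End ℂ FockL) :=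
  PowerSeries.mk fun n =>
    if h : Odd n then (2 / n : ℂ) • braH n (oddPos_ne_zero ⟨n, h⟩) else 0

/-- `⟨U|e^{-H_+[z⁻¹]}`. The powers of `H_+[u]` are taken in the endomorphism ring of `FockL`; this
is the same as for the opposite composition, as each is a power of a single element. -/
def braExpMiwa (u : FockL) : ZSeries FockL := fun m =>
  if m ≤ 0 then PowerSeries.coeff (-m).toNat (expSeries (-currentMiwa)) u else 0

end

end BInf

open BInf

namespace BInf

noncomputable section

/-! ### Exponentials of formal power series: functional equations -/

section ExpSeries

variable {σ R S : Type*} [Ring R]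

/-! Everything rests on the relation `[H_k, φ_m] = φ_{m-k}` for odd `k`. Since `H_k` with `k > 0`
kills `|0⟩`, the `H_k` commute with one another, and the nondegenerate pairing carries both facts
over to the left Fock space.

Vacuum identities. With Euler's operator `u d/du`, the claim that `e^{-H_+[u]}` sends `b 0` to `∑ b
n u^n` becomes the recurrence `n b_n = -2 ∑_{k odd} b_{n-k} H_k`. Take `b_n = ⟨0|φ_{-n}` or
`⟨0|φ_0φ_{-n}`. Commuting `H_k` to the left produces one copy of `b_n` for each odd `k ≤ n`, plus
terms containing `⟨0|H_k`. The latter vectors have generating series `-½ φ_-(-u)φ_-(u) + ¼` with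
`φ_-(u) = ∑_{n ≥ 0} φ_{-n}u^n`, and `φ_-(u)² = ½` sums them in closed form
(`vacCurrent_mul_phiMinus`, `vacCurrent_mul_phi_zero_mul`).

Vertex operator. `∂_{t_k}` acts on `⟨U|e^{H_+(t)}|V⟩` by inserting `H_k` next to `⟨U|`, so
`e^{-ξ(∂̃,1/z)}` inserts `e^{-H_+[1/z]}` there. By the vacuum identities this exchanges `⟨0|` and
`⟨1|` and attaches the nonpositive modes of `φ(z)`; multiplication by `w` undoes the exchange. The
positive modes kill both left vacua, so all of `φ(z)` is present, to the left of `e^{H_+(t)}`.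
Finally `e^{H_+(t)}φ(z) = e^{ξ(t,z)}φ(z)e^{H_+(t)}` (`corr_ketPhi`) absorbs the remaining factor
`e^{ξ(t,z)}`. -/

/-- Each factor contributes degree at least one, so the truncation in `expSeries` loses nothing. -/
theorem coeff_pow_eq_zero {A : MvPowerSeries σ R} (hA : MvPowerSeries.coeff 0 A = 0) {m : ℕ}
    {n : σ →₀ ℕ} (h : n.degree < m) : MvPowerSeries.coeff n (A ^ m) = 0 := by
  classical
  induction m generalizing n with
  | zero => omega
  | succ m ih =>
    rw [pow_succ, MvPowerSeries.coeff_mul]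
    refine Finset.sum_eq_zero fun p hp => ?_
    have hp' := congrArg Finsupp.degree (Finset.HasAntidiagonal.mem_antidiagonal.1 hp)
    rw [map_add] at hp'
    by_cases h2 : p.2 = 0
    · rw [h2, hA, mul_zero]
    · have := Nat.pos_of_ne_zero (mt (Finsupp.degree_eq_zero_iff p.2).1 h2)
      rw [ih (by omega), zero_mul]

theorem commute_of_coeff {A B : MvPowerSeries σ R}
    (h : ∀ p q, Commute (MvPowerSeries.coeff p A) (MvPowerSeries.coeff q B)) : Commute A B := by
  classical
  ext n
  rw [MvPowerSeries.coeff_mul, MvPowerSeries.coeff_mul]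
  refine Finset.sum_nbij' Prod.swap Prod.swap ?_ ?_ (fun _ _ => rfl) (fun _ _ => rfl)
    fun p _ => (h _ _).eq
  all_goals simp [Finset.HasAntidiagonal.mem_antidiagonal, add_comm]

variable [Algebra ℂ R] [Ring S] [Algebra ℂ S]

/-- A family of linear maps applied to the coefficients of a power series. -/
def coeffwise (T : (σ →₀ ℕ) → R →ₗ[ℂ] R) (A : MvPowerSeries σ R) : MvPowerSeries σ R :=
  fun n => T n (MvPowerSeries.coeff n A)

theorem coeff_coeffwise (T : (σ →₀ ℕ) → R →ₗ[ℂ] R) (A : MvPowerSeries σ R) (n : σ →₀ ℕ) :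
    MvPowerSeries.coeff n (coeffwise T A) = T n (MvPowerSeries.coeff n A) := rfl

/-- The map may depend on the exponent, so this Leibniz rule covers both a derivation of the
coefficient ring and an Euler operator, which multiplies by an additive weight. -/
theorem coeffwise_mul {T : (σ →₀ ℕ) → R →ₗ[ℂ] R}
    (hT : ∀ p q a b, T (p + q) (a * b) = T p a * b + a * T q b) (A B : MvPowerSeries σ R) :
    coeffwise T (A * B) = coeffwise T A * B + A * coeffwise T B := by
  classical
  ext n
  rw [coeff_coeffwise, map_add, MvPowerSeries.coeff_mul, MvPowerSeries.coeff_mul,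
    MvPowerSeries.coeff_mul, map_sum, ← Finset.sum_add_distrib]
  refine Finset.sum_congr rfl fun p hp => ?_
  rw [← Finset.HasAntidiagonal.mem_antidiagonal.1 hp, hT, coeff_coeffwise, coeff_coeffwise]

theorem coeffwise_one {T : (σ →₀ ℕ) → R →ₗ[ℂ] R}
    (hT : ∀ p q a b, T (p + q) (a * b) = T p a * b + a * T q b) :
    coeffwise T (1 : MvPowerSeries σ R) = 0 := by
  have h := coeffwise_mul hT (1 : MvPowerSeries σ R) 1
  rw [mul_one, mul_one, one_mul] at h
  exact left_eq_add.1 h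

theorem coeffwise_pow_succ {T : (σ →₀ ℕ) → R →ₗ[ℂ] R}
    (hT : ∀ p q a b, T (p + q) (a * b) = T p a * b + a * T q b) {A : MvPowerSeries σ R}
    (hA : Commute A (coeffwise T A)) (m : ℕ) :
    coeffwise T (A ^ (m + 1)) = (m + 1) • (coeffwise T A * A ^ m) := by
  induction m with
  | zero => simp
  | succ m ih =>
    rw [pow_succ, coeffwise_mul hT, ih, (hA.pow_left (m + 1)).eq, smul_mul_assoc, mul_assoc,
      ← pow_succ, succ_nsmul _ (m + 1)]

theorem coeff_expSeries_of_le {A : MvPowerSeries σ R} (hA : MvPowerSeries.coeff 0 A = 0)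
    {n : σ →₀ ℕ} {N : ℕ} (hN : n.degree + 1 ≤ N) :
    MvPowerSeries.coeff n (expSeries A) =
      ∑ m ∈ Finset.range N, ((m.factorial : ℂ)⁻¹) • MvPowerSeries.coeff n (A ^ m) := by
  refine Finset.sum_subset (Finset.range_mono hN) fun m _ hm => ?_
  rw [coeff_pow_eq_zero hA (by simpa using hm), smul_zero]

theorem coeff_zero_expSeries (A : MvPowerSeries σ R) :
    MvPowerSeries.coeff 0 (expSeries A) = 1 := by
  classical
  change ∑ m ∈ Finset.range ((0 : σ →₀ ℕ).degree + 1),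
    ((m.factorial : ℂ)⁻¹) • MvPowerSeries.coeff 0 (A ^ m) = 1
  simp

/-- The logarithmic derivative of an exponential. -/
theorem coeffwise_expSeries {T : (σ →₀ ℕ) → R →ₗ[ℂ] R}
    (hT : ∀ p q a b, T (p + q) (a * b) = T p a * b + a * T q b) {A : MvPowerSeries σ R}
    (hA₀ : MvPowerSeries.coeff 0 A = 0) (hA : Commute A (coeffwise T A)) :
    coeffwise T (expSeries A) = coeffwise T A * expSeries A := by
  classical
  ext n
  have hl : MvPowerSeries.coeff n (coeffwise T (expSeries A)) =
      ∑ m ∈ Finset.range (n.degree + 1),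
        ((m.factorial : ℂ)⁻¹) • MvPowerSeries.coeff n (coeffwise T A * A ^ m) := by
    -- One extra term is taken because differentiating `A ^ (m + 1)` shifts the index down by one.
    rw [coeff_coeffwise, coeff_expSeries_of_le hA₀ (Nat.le_succ (n.degree + 1)), map_sum,
      Finset.sum_range_succ']
    simp only [map_smul, ← coeff_coeffwise]
    rw [pow_zero, coeffwise_one hT, map_zero, smul_zero, add_zero]
    refine Finset.sum_congr rfl fun m _ => ?_
    rw [coeffwise_pow_succ hT hA, map_nsmul, ← Nat.cast_smul_eq_nsmul ℂ, smul_smul]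
    congr 1
    rw [Nat.factorial_succ]
    push_cast
    field_simp
  rw [hl, MvPowerSeries.coeff_mul]
  simp only [MvPowerSeries.coeff_mul, Finset.smul_sum]
  rw [Finset.sum_comm]
  refine Finset.sum_congr rfl fun p hp => ?_
  have hp' := congrArg Finsupp.degree (Finset.HasAntidiagonal.mem_antidiagonal.1 hp)
  rw [map_add] at hp'
  rw [coeff_expSeries_of_le hA₀ (show p.2.degree + 1 ≤ n.degree + 1 by omega), Finset.mul_sum]
  simp only [mul_smul_comm]

theorem commute_coeff_expSeries {A : MvPowerSeries σ R} {x : R}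
    (h : ∀ n, Commute x (MvPowerSeries.coeff n A)) (n : σ →₀ ℕ) :
    Commute x (MvPowerSeries.coeff n (expSeries A)) := by
  classical
  have hp : ∀ m n, Commute x (MvPowerSeries.coeff n (A ^ m)) := fun m => by
    induction m with
    | zero =>
      intro n
      rw [pow_zero, MvPowerSeries.coeff_one]
      split_ifs
      · exact Commute.one_right x
      · exact Commute.zero_right x
    | succ m ih =>
      intro n
      rw [pow_succ, MvPowerSeries.coeff_mul]
      exact Commute.sum_right _ _ _ fun p _ => (ih _).mul_right (h _)
  change Commute x (∑ m ∈ Finset.range (n.degree + 1),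
    ((m.factorial : ℂ)⁻¹) • MvPowerSeries.coeff n (A ^ m))
  exact Commute.sum_right _ _ _ fun m _ => (hp m n).smul_right _

theorem map_coeff_expSeries (f : R →ₐ[ℂ] S) (A : MvPowerSeries σ R) (n : σ →₀ ℕ) :
    f (MvPowerSeries.coeff n (expSeries A)) =
      MvPowerSeries.coeff n (expSeries (MvPowerSeries.map (f : R →+* S) A)) := by
  change f (∑ m ∈ Finset.range (n.degree + 1), _) = ∑ m ∈ Finset.range (n.degree + 1), _
  rw [map_sum]
  refine Finset.sum_congr rfl fun m _ => ?_
  rw [map_smul, ← map_pow, MvPowerSeries.coeff_map]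
  rfl

/-- An intertwiner of the coefficients of two series intertwines those of their exponentials. -/
theorem intertwine_expSeries {M N : Type*} [AddCommGroup M] [Module ℂ M] [AddCommGroup N]
    [Module ℂ N] (L : M →ₗ[ℂ] N) {A : MvPowerSeries σ (Module.End ℂ M)}
    {B : MvPowerSeries σ (Module.End ℂ N)}
    (h : ∀ n u, L (MvPowerSeries.coeff n A u) = MvPowerSeries.coeff n B (L u))
    (n : σ →₀ ℕ) (u : M) :
    L (MvPowerSeries.coeff n (expSeries A) u) = MvPowerSeries.coeff n (expSeries B) (L u) := by
  classical
  have hp : ∀ m n u, L ((MvPowerSeries.coeff n (A ^ m) : Module.End ℂ M) u) =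
      (MvPowerSeries.coeff n (B ^ m) : Module.End ℂ N) (L u) := fun m => by
    induction m with
    | zero =>
      intro n u
      rw [pow_zero, pow_zero, MvPowerSeries.coeff_one, MvPowerSeries.coeff_one]
      split_ifs <;> simp
    | succ m ih =>
      intro n u
      rw [pow_succ, pow_succ, MvPowerSeries.coeff_mul, MvPowerSeries.coeff_mul,
        LinearMap.sum_apply, LinearMap.sum_apply, map_sum]
      refine Finset.sum_congr rfl fun p _ => ?_
      rw [Module.End.mul_apply, Module.End.mul_apply, ih, h]
  change L ((∑ m ∈ Finset.range (n.degree + 1), (_ : Module.End ℂ M)) u) =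
    (∑ m ∈ Finset.range (n.degree + 1), (_ : Module.End ℂ N)) (L u)
  rw [LinearMap.sum_apply, LinearMap.sum_apply, map_sum]
  refine Finset.sum_congr rfl fun m _ => ?_
  rw [LinearMap.smul_apply, LinearMap.smul_apply, map_smul, hp]

/-- A weight on exponents gives a family satisfying the Leibniz rule. -/
def weightMul (R : Type*) [Ring R] [Algebra ℂ R] (wt : (σ →₀ ℕ) →+ ℕ) (n : σ →₀ ℕ) :
    R →ₗ[ℂ] R := (wt n : ℂ) • LinearMap.id

theorem weightMul_leibniz (wt : (σ →₀ ℕ) →+ ℕ) (p q : σ →₀ ℕ) (a b : R) :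
    weightMul R wt (p + q) (a * b) = weightMul R wt p a * b + a * weightMul R wt q b := by
  simp only [weightMul, LinearMap.smul_apply, LinearMap.id_apply, map_add, Nat.cast_add,
    add_smul, LinearMap.add_apply, smul_mul_assoc, mul_smul_comm]

/-- The Euler operators used are `u d/du` in one variable and `t_k ∂/∂t_k` in the times; they turn
the exponential into a recurrence for its coefficients. -/
theorem coeffwise_weightMul_expSeries (wt : (σ →₀ ℕ) →+ ℕ) {A : MvPowerSeries σ R}
    (hA₀ : MvPowerSeries.coeff 0 A = 0)
    (hA : ∀ p q, Commute (MvPowerSeries.coeff p A) (MvPowerSeries.coeff q A)) :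
    coeffwise (weightMul R wt) (expSeries A) =
      coeffwise (weightMul R wt) A * expSeries A :=
  coeffwise_expSeries (weightMul_leibniz wt) hA₀
    (commute_of_coeff fun p q => (hA p q).smul_right _)

end ExpSeries

theorem unit_finsupp_eq (n : Unit →₀ ℕ) : n = Finsupp.single () (n ()) := by ext; simp

/-- The coefficients of an exponential in one variable, applied to a vector, are determined by
the recurrence that comes from the logarithmic derivative. -/
theorem coeff_expSeries_apply_eq {M : Type*} [AddCommGroup M] [Module ℂ M]
    {A : PowerSeries (Module.End ℂ M)} (hA₀ : PowerSeries.coeff 0 A = 0)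
    (hA : ∀ p q, Commute (PowerSeries.coeff p A) (PowerSeries.coeff q A)) (b : ℕ → M)
    (hb : ∀ n : ℕ, (n : ℂ) • b n = ∑ p ∈ Finset.HasAntidiagonal.antidiagonal n,
      (p.1 : ℂ) • PowerSeries.coeff p.1 A (b p.2)) (n : ℕ) :
    PowerSeries.coeff n (expSeries A) (b 0) = b n := by
  have key := coeffwise_weightMul_expSeries unitWt (A := A)
    (by rw [← hA₀]; exact congrArg (MvPowerSeries.coeff · A) (unit_finsupp_eq 0))
    (fun p q => by rw [unit_finsupp_eq p, unit_finsupp_eq q]; exact hA _ _)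
  induction n using Nat.strong_induction_on with
  | _ n ih =>
    rcases Nat.eq_zero_or_pos n with rfl | hn
    · have : PowerSeries.coeff 0 (expSeries A) = 1 := by
        rw [← coeff_zero_expSeries A]
        exact congrArg (MvPowerSeries.coeff · (expSeries A)) (unit_finsupp_eq 0).symm
      rw [this, Module.End.one_apply]
    have h1 := congrArg (fun F : PowerSeries (Module.End ℂ M) => PowerSeries.coeff n F (b 0)) key
    have hw : ∀ (F : PowerSeries (Module.End ℂ M)) (m : ℕ),
        PowerSeries.coeff m (coeffwise (weightMul _ unitWt) F : PowerSeries _) =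
          (m : ℂ) • PowerSeries.coeff m F := fun F m => by
      change ((unitWt (Finsupp.single () m) : ℕ) : ℂ) • PowerSeries.coeff m F = _
      simp [unitWt]
    simp only [PowerSeries.coeff_mul] at h1
    rw [hw, LinearMap.smul_apply, LinearMap.sum_apply] at h1
    have hn' : (n : ℂ) ≠ 0 := Nat.cast_ne_zero.2 hn.ne'
    refine smul_right_injective M hn' ?_
    change (n : ℂ) • _ = (n : ℂ) • _
    rw [h1, hb]
    refine Finset.sum_congr rfl fun p hp => ?_
    have hp' := Finset.HasAntidiagonal.mem_antidiagonal.1 hp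
    rw [hw, Module.End.mul_apply, LinearMap.smul_apply]
    -- The term `p.1 = 0` would need the claim at `n` itself, but it carries the factor `0`.
    rcases Nat.eq_zero_or_pos p.1 with h0 | h0
    · rw [h0]; simp
    · rw [ih p.2 (by omega)]

/-! ### The current modes and the neutral fermions -/

/-- The vacuum is cyclic, so an operator identity need only be checked there and shown to survive
each fermion. -/
theorem ketOf_induction {p : FockR → Prop} (vac : p (ketOf 1))
    (add : ∀ u v, p u → p v → p (u + v)) (smul : ∀ (c : ℂ) u, p u → p (c • u))
    (phi : ∀ n u, p u → p (ketPhi n u)) (u : FockR) : p u := by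
  obtain ⟨d, hd⟩ := exists_mem_ketFilt u
  induction hd using Submodule.span_induction with
  | mem x hx =>
    obtain ⟨l, -, -, rfl⟩ := hx
    induction l with
    | nil => simpa using vac
    | cons n l ih =>
      rw [List.map_cons, List.prod_cons, ← ketPhi_ketOf]
      exact phi _ _ ih
  | zero => simpa using smul 0 _ vac
  | add x y _ _ hx hy => exact add _ _ hx hy
  | smul c x _ hx => exact smul _ _ hx

theorem neg_one_zpow_mul_self (m : ℤ) : (-1 : ℂ) ^ m * (-1 : ℂ) ^ m = 1 := by
  rw [← mul_zpow]; simp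

/-- Moving `φ_m` to the left past the two fermions of the term leaves one contraction with each of
them. -/
theorem ketHTerm_ketPhi (k i m : ℤ) (u : FockR) :
    ketHTerm k i (ketPhi m u) = ketPhi m (ketHTerm k i u) +
      ((if i = m - k then (-1 : ℂ) ^ (i + 1) * (-1) ^ m else 0) • ketPhi i u +
        (if i = -m then (1 : ℂ) else 0) • ketPhi (-i - k) u) := by
  simp only [ketHTerm, LinearMap.smul_apply, LinearMap.comp_apply]
  rw [ketPhi_swap (-i - k) m, map_sub, map_smul, ketPhi_swap i m, map_smul]
  have h1 : (-i - k = -m) ↔ i = m - k := by constructor <;> intro h <;> omega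
  simp only [h1]
  split_ifs with h h' h'
  · have e1 : (-1 : ℂ) ^ (-i - k) = (-1) ^ m := by
      rw [show -i - k = -m by omega, zpow_neg, ← inv_zpow]; norm_num
    have e2 : (-1 : ℂ) ^ (i + 1) * (-1) ^ i = -1 := by
      rw [zpow_add₀ (by norm_num), mul_right_comm, neg_one_zpow_mul_self]; norm_num
    rw [e1, smul_sub, smul_sub, smul_smul, smul_smul, e2]
    module
  · have e1 : (-1 : ℂ) ^ (-i - k) = (-1) ^ m := by
      rw [show -i - k = -m by omega, zpow_neg, ← inv_zpow]; norm_num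
    rw [e1]
    module
  · have e2 : (-1 : ℂ) ^ (i + 1) * (-1) ^ i = -1 := by
      rw [zpow_add₀ (by norm_num), mul_right_comm, neg_one_zpow_mul_self]; norm_num
    rw [smul_sub, smul_sub, smul_smul _ ((-1 : ℂ) ^ i), e2]
    module
  · module

/-- `[H_k, φ_m] = φ_{m-k}` for odd `k`. -/
theorem ketH_ketPhi (k : OddPos) (m : ℤ) (u : FockR) :
    ketH k (oddPos_ne_zero k) (ketPhi m u) =
      ketPhi m (ketH k (oddPos_ne_zero k) u) + ketPhi (m - (k : ℕ)) u := by
  have hk : Odd ((k : ℕ) : ℤ) := by exact_mod_cast k.2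
  have hs1 : (Function.support fun i : ℤ => (if i = m - (k : ℕ) then
      (-1 : ℂ) ^ (i + 1) * (-1) ^ m else 0) • ketPhi i u).Finite :=
    (Set.finite_singleton (m - ((k : ℕ) : ℤ))).subset fun i hi => by
      by_contra h; exact hi (by simp only [if_neg (show ¬ i = m - (k : ℕ) from h), zero_smul])
  have hs2 : (Function.support fun i : ℤ => (if i = -m then (1 : ℂ) else 0) •
      ketPhi (-i - (k : ℕ)) u).Finite :=
    (Set.finite_singleton (-m)).subset fun i hi => by
      by_contra h; exact hi (by simp only [if_neg (show ¬ i = -m from h), zero_smul])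
  -- Oddness of `k` enters here: the two contractions agree, which cancels the factor `1/2` in
  -- `H_k`. For even `k` they would have opposite signs.
  have hsign : (-1 : ℂ) ^ (m - ((k : ℕ) : ℤ) + 1) * (-1) ^ m = 1 := by
    have he : Even (m - ((k : ℕ) : ℤ) + 1 + m) := by
      obtain ⟨r, hr⟩ := hk
      exact ⟨m - r, by omega⟩
    rw [← zpow_add₀ (by norm_num), he.neg_one_zpow]
  have hf1 : ∑ᶠ i : ℤ, (if i = m - (k : ℕ) then (-1 : ℂ) ^ (i + 1) * (-1) ^ m else 0) •
      ketPhi i u = ketPhi (m - (k : ℕ)) u := by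
    rw [finsum_eq_single _ (m - ((k : ℕ) : ℤ)) (fun i hi => by rw [if_neg hi, zero_smul]),
      if_pos rfl, hsign, one_smul]
  have hf2 : ∑ᶠ i : ℤ, (if i = -m then (1 : ℂ) else 0) • ketPhi (-i - (k : ℕ)) u =
      ketPhi (m - (k : ℕ)) u := by
    rw [finsum_eq_single _ (-m) (fun i hi => by rw [if_neg hi, zero_smul]),
      if_pos rfl, one_smul, neg_neg]
  simp only [ketH, LinearMap.smul_apply, locSum, LinearMap.coe_mk, AddHom.coe_mk]
  simp only [ketHTerm_ketPhi]
  rw [finsum_add_distrib, finsum_add_distrib hs1 hs2, map_smul, map_finsum]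
  · rw [hf1, hf2]
    module
  · exact ketHTerm_finite _ (oddPos_ne_zero k) u
  · exact (ketHTerm_finite _ (oddPos_ne_zero k) u).subset fun i hi h => hi (by simp [h])
  · exact (hs1.union hs2).subset (Function.support_add _ _)

theorem ketOf_one_mem : ketOf 1 ∈ ketFilt 0 :=
  Submodule.subset_span ⟨[], by simp, by simp, by simp⟩

/-- `H_k` lowers the degree by `k > 0`, and nothing lies below the vacuum. -/
theorem ketH_vacuum (k : OddPos) : ketH k (oddPos_ne_zero k) (ketOf 1) = 0 := by
  have h := lowers_ketH k 0 _ ketOf_one_mem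
  have := k.2.pos
  rwa [ketFilt_neg (by omega), Submodule.mem_bot] at h

/-- Both operators kill the vacuum, and their commutators with fermions are shifts of the mode,
which commute. -/
theorem commute_ketH (k l : OddPos) :
    Commute (ketH k (oddPos_ne_zero k)) (ketH l (oddPos_ne_zero l)) := by
  refine LinearMap.ext fun u => ?_
  rw [Module.End.mul_apply, Module.End.mul_apply]
  induction u using ketOf_induction with
  | vac => rw [ketH_vacuum, ketH_vacuum, map_zero, map_zero]
  | add u v hu hv => simp only [map_add, hu, hv]
  | smul c u hu => simp only [map_smul, hu]
  | phi n u hu =>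
    simp only [ketH_ketPhi, map_add, hu]
    rw [show n - ((k : ℕ) : ℤ) - (l : ℕ) = n - (l : ℕ) - (k : ℕ) by ring]
    abel

/-! ### Adjointness and nondegeneracy of the pairing -/

theorem pairing_braPhi (n : ℤ) (u : FockL) (v : FockR) :
    pairing (braPhi n u) v = pairing u (ketPhi n v) := by
  obtain ⟨a, rfl⟩ := Submodule.Quotient.mk_surjective _ u
  obtain ⟨b, rfl⟩ := Submodule.Quotient.mk_surjective _ v
  change vev (a * phi n * b) = vev (a * (phi n * b))
  rw [mul_assoc]

theorem pairing_braH (n : ℤ) (hn : n ≠ 0) (u : FockL) (v : FockR) :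
    pairing (braH n hn u) v = pairing u (ketH n hn v) := by
  change (pairing.flip v) (braH n hn u) = _
  simp only [braH, ketH, LinearMap.smul_apply, locSum, LinearMap.coe_mk, AddHom.coe_mk, map_smul]
  rw [map_finsum _ (braHTerm_finite n hn u), map_finsum _ (ketHTerm_finite n hn v)]
  congr 1
  refine finsum_congr fun i => ?_
  simp only [braHTerm, ketHTerm, LinearMap.smul_apply, LinearMap.comp_apply, map_smul,
    LinearMap.flip_apply, pairing_braPhi]

/-- The subspace of `FockL` spanned by the vectors `⟨0|φ_{n_1} ⋯ φ_{n_k}` with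
`0 ≥ n_1 > ⋯ > n_k ≥ -N`. -/
def braSpan : ℕ → Submodule ℂ FockL
  | 0 => Submodule.span ℂ {bra0, braOf (phi 0)}
  | N + 1 => braSpan N ⊔ (braSpan N).map (braPhi (-(N + 1 : ℕ)))

theorem braOf_phi (n : ℤ) : braOf (phi n) = braPhi n bra0 := by
  rw [bra0, braPhi_braOf, one_mul]

theorem braPhi_bra0 {n : ℤ} (hn : 0 < n) : braPhi n bra0 = 0 := by
  rw [← braOf_phi, ← mul_one (phi n), braOf_eq_zero n hn]

theorem braPhi_zero_braPhi_zero (u : FockL) :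
    braPhi 0 (braPhi 0 u) = (1 / 2 : ℂ) • u := by
  have h := braPhi_swap 0 0 u
  rw [if_pos (by simp), zpow_zero, one_smul, eq_sub_iff_add_eq] at h
  conv_rhs => rw [← h]
  module

theorem braPhi_braPhi_self {n : ℤ} (hn : n ≠ 0) (u : FockL) : braPhi n (braPhi n u) = 0 := by
  have h := braPhi_swap n n u
  rw [if_neg (by omega), zero_smul, zero_sub, eq_neg_iff_add_eq_zero, ← two_smul ℂ] at h
  exact (smul_eq_zero.1 h).resolve_left two_ne_zero

/-- None of the modes `0, …, -N` is conjugate to `φ_n`, so `φ_n` anticommutes through to `⟨0|`,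
which it kills. -/
theorem braPhi_eq_zero_of_mem_braSpan {N : ℕ} {u : FockL} (hu : u ∈ braSpan N) {n : ℤ}
    (hn : (N : ℤ) < n) : braPhi n u = 0 := by
  induction N generalizing u with
  | zero =>
    have hn0 : 0 < n := by simpa using hn
    refine (Submodule.span_le (p := LinearMap.ker (braPhi n))).2 ?_ hu
    rintro x (rfl | rfl)
    · exact braPhi_bra0 hn0
    · rw [braOf_phi, SetLike.mem_coe, LinearMap.mem_ker, braPhi_swap, if_neg (by omega),
        braPhi_bra0 hn0]
      simp
  | succ N ih =>
    obtain ⟨y, hy, z, hz, rfl⟩ := Submodule.mem_sup.1 hu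
    obtain ⟨w, hw, rfl⟩ := hz
    rw [map_add, ih hy (by push_cast at hn; omega), braPhi_swap, if_neg (by omega),
      ih hw (by push_cast at hn; omega)]
    simp

theorem braPhi_mem_braSpan_of_le {N : ℕ} {u : FockL} (hu : u ∈ braSpan N) {n : ℤ}
    (hn : |n| ≤ N) : braPhi n u ∈ braSpan N := by
  induction N generalizing u n with
  | zero =>
    obtain rfl : n = 0 := by simpa using hn
    refine (Submodule.span_le (p := (braSpan 0).comap (braPhi 0))).2 ?_ hu
    rintro x (rfl | rfl)
    · exact Submodule.subset_span (Or.inr (braOf_phi 0).symm)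
    · rw [braOf_phi, SetLike.mem_coe, Submodule.mem_comap, braPhi_zero_braPhi_zero]
      exact Submodule.smul_mem _ _ (Submodule.subset_span (Or.inl rfl))
  | succ N ih =>
    obtain ⟨y, hy, z, hz, rfl⟩ := Submodule.mem_sup.1 hu
    obtain ⟨w, hw, rfl⟩ := hz
    rw [map_add]
    -- The new mode squares to zero, so it is never needed twice. Any other mode preserves or kills
    -- `braSpan N`, and passes the new mode up to a scalar.
    by_cases h1 : n = -(N + 1 : ℕ)
    · rw [← h1, braPhi_braPhi_self (by omega), add_zero, h1]
      exact Submodule.mem_sup_right ⟨y, hy, rfl⟩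
    have h2 : ∀ x ∈ braSpan N, braPhi n x ∈ braSpan N := fun x hx => by
      by_cases h3 : n = (N + 1 : ℕ)
      · rw [braPhi_eq_zero_of_mem_braSpan hx (by omega)]; exact zero_mem _
      · exact ih hx (by rw [abs_le] at hn ⊢; push_cast at hn h1 h3 ⊢; omega)
    rw [braPhi_swap]
    exact add_mem (Submodule.mem_sup_left (h2 y hy)) (sub_mem
      (Submodule.smul_mem _ _ (Submodule.mem_sup_left hw))
      (Submodule.mem_sup_right ⟨_, h2 w hw, rfl⟩))

theorem braSpan_mono : Monotone braSpan :=
  monotone_nat_of_le_succ fun _ => le_sup_left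

theorem exists_mem_braSpan (u : FockL) : ∃ N, u ∈ braSpan N := by
  obtain ⟨a, rfl⟩ := Submodule.Quotient.mk_surjective _ u
  change ∃ N, braOf a ∈ braSpan N
  induction a using CliffordAlgebra.right_induction with
  | algebraMap r =>
    refine ⟨0, ?_⟩
    have : braOf (algebraMap ℂ ClB r) = r • bra0 := by
      rw [Algebra.algebraMap_eq_smul_one]; rfl
    rw [this]
    exact Submodule.smul_mem _ _ (Submodule.subset_span (Or.inl rfl))
  | add x y hx hy =>
    obtain ⟨d, hd⟩ := hx
    obtain ⟨e, he⟩ := hy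
    exact ⟨max d e, add_mem (braSpan_mono (le_max_left _ _) hd)
      (braSpan_mono (le_max_right _ _) he)⟩
  | mul_ι v x hx =>
    induction v using Finsupp.induction_linear with
    | zero => exact ⟨0, by rw [map_zero, mul_zero]; exact zero_mem (braSpan 0)⟩
    | add f g hf hg =>
      obtain ⟨d, hd⟩ := hf
      obtain ⟨e, he⟩ := hg
      refine ⟨max d e, ?_⟩
      rw [map_add, mul_add]
      exact add_mem (braSpan_mono (le_max_left _ _) hd) (braSpan_mono (le_max_right _ _) he)
    | single n c =>
      obtain ⟨d, hd⟩ := hx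
      refine ⟨max d n.natAbs, ?_⟩
      have : braOf (x * CliffordAlgebra.ι fermQ (Finsupp.single n c)) =
          c • braPhi n (braOf x) := by
        have h : Finsupp.single n c = c • Finsupp.single n (1 : ℂ) := by simp
        rw [h, map_smul, mul_smul_comm]; rfl
      rw [this]
      exact Submodule.smul_mem _ _ (braPhi_mem_braSpan_of_le
        (braSpan_mono (le_max_left _ _) hd) (by rw [abs_le]; omega))

/-- The pairing is nondegenerate on the left Fock space. -/
theorem eq_zero_of_pairing_eq_zero {u : FockL} (hu : ∀ v, pairing u v = 0) : u = 0 := by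
  obtain ⟨N, hN⟩ := exists_mem_braSpan u
  induction N generalizing u with
  | zero =>
    obtain ⟨α, β, rfl⟩ := Submodule.mem_span_pair.1 hN
    have h0 : pairing bra0 (ketOf 1) = 1 := by
      rw [bra0, pairing_braOf_ketOf, one_mul, vev_one]
    have h1 : pairing (braPhi 0 bra0) (ketOf 1) = 0 := by
      rw [← braOf_phi, pairing_braOf_ketOf, mul_one, vev_phi_zero]
    -- Pairing with `|0⟩` and `φ_0|0⟩` separates the two coefficients.
    have h2 := hu (ketOf 1)
    have h3 := hu (ketPhi 0 (ketOf 1))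
    rw [← pairing_braPhi, braOf_phi, map_add, map_smul, map_smul, braPhi_zero_braPhi_zero] at h3
    rw [braOf_phi] at h2 ⊢
    simp only [map_add, map_smul, LinearMap.add_apply, LinearMap.smul_apply, h0, h1,
      smul_eq_mul, mul_zero, mul_one, add_zero, zero_add] at h2 h3
    have h4 : β = 0 := by simpa using h3
    rw [h2, h4, zero_smul, zero_smul, add_zero]
  | succ N ih =>
    obtain ⟨y, hy, z, hz, rfl⟩ := Submodule.mem_sup.1 hN
    obtain ⟨w, hw, rfl⟩ := hz
    have hM : (N : ℤ) < (N + 1 : ℕ) := by omega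
    -- `φ_{N+1}` kills `braSpan N`, so only its contraction with `φ_{-(N+1)}` survives and isolates
    -- `w`.
    have h : braPhi (N + 1 : ℕ) (y + braPhi (-(N + 1 : ℕ)) w) =
        ((-1 : ℂ) ^ (-(N + 1 : ℕ) : ℤ)) • w := by
      rw [map_add, braPhi_swap, braPhi_eq_zero_of_mem_braSpan hy hM,
        braPhi_eq_zero_of_mem_braSpan hw hM, if_pos rfl]
      simp
    have hw0 : w = 0 := ih (fun v => by
      have h1 := hu (ketPhi (N + 1 : ℕ) v)
      rw [← pairing_braPhi, h, map_smul, LinearMap.smul_apply, smul_eq_mul] at h1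
      exact (mul_eq_zero.1 h1).resolve_left (zpow_ne_zero _ (by norm_num))) hw
    subst hw0
    rw [map_zero, add_zero] at hu ⊢
    exact ih hu hy

/-- Identities on the left Fock space can thus be read off from their adjoints on the right one,
without handling the locally finite sums again. -/
theorem eq_of_pairing_eq {u u' : FockL} (h : ∀ v, pairing u v = pairing u' v) : u = u' :=
  sub_eq_zero.1 (eq_zero_of_pairing_eq_zero fun v => by
    rw [map_sub, LinearMap.sub_apply, h, sub_self])

/-- `φ_m H_k = H_k φ_m - φ_{m-k}`, acting from the right. -/
theorem braH_braPhi (k : OddPos) (m : ℤ) (u : FockL) :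
    braH k (oddPos_ne_zero k) (braPhi m u) =
      braPhi m (braH k (oddPos_ne_zero k) u) - braPhi (m - (k : ℕ)) u :=
  eq_of_pairing_eq fun v => by
    rw [map_sub, LinearMap.sub_apply, pairing_braH, pairing_braPhi, pairing_braPhi, pairing_braH,
      pairing_braPhi, ketH_ketPhi, map_add, add_sub_cancel_right]

theorem commute_braH (k l : OddPos) :
    Commute (braH k (oddPos_ne_zero k)) (braH l (oddPos_ne_zero l)) :=
  LinearMap.ext fun u => eq_of_pairing_eq fun v => by
    rw [Module.End.mul_apply, Module.End.mul_apply]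
    simp only [pairing_braH]
    exact congrArg (pairing u) (LinearMap.congr_fun (commute_ketH l k).eq v)

/-! ### The left vacua and the exponential of the currents -/

/-- `∑_{n ≥ 0} φ_{-n} u^n`. -/
def phiMinus : PowerSeries ClB := PowerSeries.mk fun n => phi (-n)

/-- `∑_{n ≥ 0} φ_{-n} (-u)^n`. -/
def phiMinusNeg : PowerSeries ClB := PowerSeries.mk fun n => (-1 : ℂ) ^ n • phi (-n)

theorem phi_neg_anticomm {a b : ℕ} (h : a + b ≠ 0) :
    phi (-a) * phi (-b) + phi (-b) * phi (-a) = 0 := by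
  rw [phi_anticomm, if_neg (by omega), map_zero]

theorem phi_zero_mul_self : phi 0 * phi 0 = algebraMap ℂ ClB (1 / 2) := by
  have h := phi_anticomm 0 0
  rw [if_pos (by simp), zpow_zero, ← two_smul ℂ, map_one] at h
  rw [← smul_right_injective ClB (two_ne_zero (α := ℂ)) |>.eq_iff, h, Algebra.algebraMap_eq_smul_one,
    smul_smul]
  norm_num

/-- Nonpositive modes anticommute, except `φ_0` with itself: twice a coefficient of positive degree
is a sum of vanishing anticommutators. -/
theorem phiMinus_mul_self : phiMinus * phiMinus = PowerSeries.C (algebraMap ℂ ClB (1 / 2)) := by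
  ext n
  rw [PowerSeries.coeff_C]
  split_ifs with hn
  · subst hn
    simp [PowerSeries.coeff_mul, phiMinus, phi_zero_mul_self]
  · have h : (2 : ℂ) • PowerSeries.coeff n (phiMinus * phiMinus) = 0 := by
      rw [two_smul, PowerSeries.coeff_mul]
      conv_lhs => enter [2]; rw [← Finset.Nat.sum_antidiagonal_swap]
      rw [← Finset.sum_add_distrib]
      refine Finset.sum_eq_zero fun p hp => ?_
      have := Finset.HasAntidiagonal.mem_antidiagonal.1 hp
      simp only [phiMinus, PowerSeries.coeff_mk, Prod.fst_swap, Prod.snd_swap]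
      exact phi_neg_anticomm (by omega)
    exact (smul_eq_zero.1 h).resolve_left two_ne_zero

theorem phiMinusNeg_mul_add : phiMinusNeg * phiMinus + phiMinus * phiMinusNeg = 1 := by
  ext n
  rw [map_add, PowerSeries.coeff_mul, PowerSeries.coeff_mul]
  conv_lhs => enter [2]; rw [← Finset.Nat.sum_antidiagonal_swap]
  rw [← Finset.sum_add_distrib, PowerSeries.coeff_one]
  split_ifs with hn
  · subst hn
    simp [phiMinus, phiMinusNeg, phi_zero_mul_self, ← map_add]
    norm_num
  · refine Finset.sum_eq_zero fun p hp => ?_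
    have := Finset.HasAntidiagonal.mem_antidiagonal.1 hp
    simp only [phiMinus, phiMinusNeg, PowerSeries.coeff_mk, Prod.fst_swap, Prod.snd_swap,
      smul_mul_assoc, mul_smul_comm]
    rw [← smul_add, phi_neg_anticomm (by omega), smul_zero]

/-- The substitution `u ↦ -u` exchanges the two series. -/
theorem coeff_phiMinusNeg_mul_swap (n : ℕ) :
    PowerSeries.coeff n (phiMinus * phiMinusNeg) =
      (-1 : ℂ) ^ n • PowerSeries.coeff n (phiMinusNeg * phiMinus) := by
  rw [PowerSeries.coeff_mul, PowerSeries.coeff_mul, Finset.smul_sum]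
  refine Finset.sum_congr rfl fun p hp => ?_
  have := Finset.HasAntidiagonal.mem_antidiagonal.1 hp
  simp only [phiMinus, phiMinusNeg, PowerSeries.coeff_mk, smul_mul_assoc, mul_smul_comm, smul_smul]
  rw [← this, pow_add, mul_right_comm, ← mul_pow]
  norm_num

theorem phi_zero_mul_phiMinus :
    PowerSeries.C (phi 0) * phiMinus = 1 - phiMinus * PowerSeries.C (phi 0) := by
  rw [eq_sub_iff_add_eq]
  ext n
  rw [map_add, PowerSeries.coeff_C_mul, PowerSeries.coeff_mul_C, PowerSeries.coeff_one]
  simp only [phiMinus, PowerSeries.coeff_mk]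
  rw [phi_anticomm]
  by_cases h : n = 0
  · simp [h]
  · rw [if_neg (by omega), if_neg h, map_zero]

/-- The elements of `Cl(W_B)` that represent the vectors `⟨0|H_k`, for odd `k`, as a series. -/
def vacCurrent : PowerSeries ClB :=
  (-1 / 2 : ℂ) • (phiMinusNeg * phiMinus) + PowerSeries.C (algebraMap ℂ ClB (1 / 4))

/-- The symmetry under `u ↦ -u` and the anticommutator force the even part of `phiMinusNeg *
phiMinus` to be the constant `1/2`, which the summand `1/4` cancels. Sums over odd `k` may therefore
be taken as full products of power series. -/
theorem coeff_vacCurrent_of_even {n : ℕ} (hn : Even n) : PowerSeries.coeff n vacCurrent = 0 := by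
  have h1 := congrArg (PowerSeries.coeff n) phiMinusNeg_mul_add
  rw [map_add, coeff_phiMinusNeg_mul_swap, hn.neg_one_pow, one_smul] at h1
  have h2 : PowerSeries.coeff n (phiMinusNeg * phiMinus) =
      (1 / 2 : ℂ) • PowerSeries.coeff n (1 : PowerSeries ClB) := by
    rw [← h1]; module
  rw [vacCurrent, map_add, PowerSeries.coeff_smul, h2, PowerSeries.coeff_C, PowerSeries.coeff_one,
    Algebra.algebraMap_eq_smul_one]
  split_ifs
  · module
  · simp

theorem braOf_add (a b : ClB) : braOf (a + b) = braOf a + braOf b := rfl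

theorem braOf_smul (c : ℂ) (a : ClB) : braOf (c • a) = c • braOf a := rfl

/-- `a ↦ ⟨0|a` as a linear map. -/
def braOfLin : ClB →ₗ[ℂ] FockL where
  toFun := braOf
  map_add' := braOf_add
  map_smul' := braOf_smul

/-- In `⟨0|φ_iφ_{-i-k}` only `-k ≤ i ≤ 0` survives: otherwise one fermion has positive mode, and the
two anticommute because `k ≠ 0`. -/
theorem braH_bra0 (k : OddPos) :
    braH k (oddPos_ne_zero k) bra0 = braOf (PowerSeries.coeff k vacCurrent) := by
  have hk : ((k : ℕ) : ℕ) ≠ 0 := k.2.pos.ne'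
  simp only [braH, LinearMap.smul_apply, locSum, LinearMap.coe_mk, AddHom.coe_mk]
  rw [vacCurrent, map_add, PowerSeries.coeff_smul, PowerSeries.coeff_C, if_neg hk, add_zero,
    braOf_smul, PowerSeries.coeff_mul]
  change _ = _ • braOfLin _
  rw [map_sum, Finset.Nat.sum_antidiagonal_eq_sum_range_succ_mk]
  have hsub : (Function.support fun i : ℤ => braHTerm k i bra0) ⊆
      ((Finset.range ((k : ℕ) + 1)).image fun a : ℕ => -(a : ℤ) : Finset ℤ) := by
    intro i hi
    by_contra hc
    apply hi
    simp only [braHTerm, LinearMap.smul_apply, LinearMap.comp_apply]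
    rcases lt_or_ge 0 i with h | h
    · rw [braPhi_bra0 h]; simp
    · have h1 : 0 < -i - ((k : ℕ) : ℤ) := by
        by_contra h2
        exact hc (by
          simp only [Finset.coe_image, Set.mem_image, Finset.mem_coe,
            Finset.mem_range]
          exact ⟨i.natAbs, by omega, by omega⟩)
      rw [braPhi_swap, if_neg (by omega), braPhi_bra0 h1]; simp
  rw [finsum_eq_sum_of_support_subset _ hsub,
    Finset.sum_image fun a _ b _ h => by simpa using h, Finset.smul_sum, Finset.smul_sum]
  refine Finset.sum_congr rfl fun a ha => ?_
  have ha' : a ≤ k := by simpa [Nat.lt_succ_iff] using ha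
  have hs : (-1 : ℂ) ^ (-(a : ℤ) + 1) = -(-1) ^ a := by
    rw [zpow_add₀ (by norm_num), zpow_neg, ← inv_zpow]; norm_num
  simp only [braHTerm, LinearMap.smul_apply, LinearMap.comp_apply,
    phiMinus, phiMinusNeg, PowerSeries.coeff_mk, smul_mul_assoc, map_smul, hs]
  rw [← braOf_phi, braPhi_braOf, Nat.cast_sub ha',
    show -(-(a : ℤ)) - ((k : ℕ) : ℤ) = -(((k : ℕ) : ℤ) - a) by ring]
  change _ = _ • _ • braOf _
  module

/-- The odd part of `∑ φ_{-n} u^n`. -/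
def phiMinusOdd : PowerSeries ClB := (1 / 2 : ℂ) • (phiMinus - phiMinusNeg)

theorem coeff_phiMinusOdd (n : ℕ) :
    PowerSeries.coeff n phiMinusOdd = (if Odd n then (1 : ℂ) else 0) • phi (-n) := by
  simp only [phiMinusOdd, PowerSeries.coeff_smul, map_sub, phiMinus, phiMinusNeg,
    PowerSeries.coeff_mk]
  split_ifs with h
  · rw [h.neg_one_pow]; module
  · rw [(Nat.not_odd_iff_even.1 h).neg_one_pow]; module

theorem C_algebraMap_mul (c : ℂ) (F : PowerSeries ClB) :
    PowerSeries.C (algebraMap ℂ ClB c) * F = c • F := by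
  ext n
  rw [PowerSeries.coeff_C_mul, PowerSeries.coeff_smul, Algebra.smul_def]

/-- `φ_-(u)² = ½` collapses the product to `¼(φ_-(u) - φ_-(-u))`. This evaluates `∑ ⟨0|H_kφ_{-j}`
over `k + j = n`. -/
theorem vacCurrent_mul_phiMinus : vacCurrent * phiMinus = (1 / 2 : ℂ) • phiMinusOdd := by
  rw [vacCurrent, add_mul, smul_mul_assoc, mul_assoc, phiMinus_mul_self, C_algebraMap_mul]
  have : phiMinusNeg * PowerSeries.C (algebraMap ℂ ClB (1 / 2)) = (1 / 2 : ℂ) • phiMinusNeg := by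
    ext n
    rw [PowerSeries.coeff_mul_C, PowerSeries.coeff_smul, ← Algebra.commutes, Algebra.smul_def]
  rw [this, phiMinusOdd]
  module

/-- `phiMinusOdd * phiMinus` is `vacCurrent` itself, and it cancels the copy produced by moving
`φ_0` past `φ_-(u)`. -/
theorem vacCurrent_mul_phi_zero_mul :
    vacCurrent * (PowerSeries.C (phi 0) * phiMinus) - phiMinusOdd * phiMinus =
      (-1 / 2 : ℂ) • (phiMinusOdd * PowerSeries.C (phi 0)) := by
  have h : phiMinusOdd * phiMinus = vacCurrent := by
    rw [phiMinusOdd, smul_mul_assoc, sub_mul, phiMinus_mul_self, vacCurrent, smul_sub,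
      ← C_algebraMap_mul (1 / 2) (PowerSeries.C _), ← map_mul, ← map_mul]
    norm_num
    module
  rw [phi_zero_mul_phiMinus, mul_sub, mul_one, ← mul_assoc, vacCurrent_mul_phiMinus, h,
    smul_mul_assoc]
  module

/-- The sum counts the odd `k ≤ n`. The excess for odd `n` is what the terms with `⟨0|H_k` must
compensate. -/
theorem two_mul_sum_odd_antidiagonal (n : ℕ) :
    2 * ∑ p ∈ Finset.HasAntidiagonal.antidiagonal n, (if Odd p.1 then (1 : ℂ) else 0) =
      n + if Odd n then 1 else 0 := by
  rw [Finset.Nat.sum_antidiagonal_eq_sum_range_succ_mk]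
  induction n with
  | zero => simp
  | succ n ih =>
    rw [Finset.sum_range_succ, mul_add, ih]
    by_cases h : Odd n
    · have : ¬ Odd (n + 1) := by simpa [Nat.odd_add_one] using h
      simp [h, this]
    · have : Odd (n + 1) := by simpa [Nat.odd_add_one] using h
      simp [h, this]; ring

theorem coeff_neg_currentMiwa (n : ℕ) :
    PowerSeries.coeff n (-currentMiwa) = if h : Odd n then
      (-2 / n : ℂ) • braH n (oddPos_ne_zero ⟨n, h⟩) else 0 := by
  rw [map_neg, currentMiwa, PowerSeries.coeff_mk]
  split_ifs
  · rw [neg_div, neg_smul]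
  · exact neg_zero

theorem commute_coeff_neg_currentMiwa (p q : ℕ) :
    Commute (PowerSeries.coeff p (-currentMiwa)) (PowerSeries.coeff q (-currentMiwa)) := by
  rw [coeff_neg_currentMiwa, coeff_neg_currentMiwa]
  split_ifs with hp hq
  · exact ((commute_braH ⟨p, hp⟩ ⟨q, hq⟩).smul_left _).smul_right _
  all_goals simp

/-- If `H_k` acts on the vectors `b n`, up to a multiple of `b (k + n)`, through `c k n`, and
the `c`'s add up suitably, then `e^{-H_+[u]}` maps `b 0` to `∑ b n u^n`. -/
theorem coeff_expSeries_neg_currentMiwa (b : ℕ → FockL) (c : ℕ → ℕ → FockL)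
    (hbc : ∀ (k : OddPos) n, braH k (oddPos_ne_zero k) (b n) = c k n - b (k + n))
    (hc : ∀ n, ∑ p ∈ Finset.HasAntidiagonal.antidiagonal n,
      (if Odd p.1 then (1 : ℂ) else 0) • c p.1 p.2 =
        (1 / 2 : ℂ) • (if Odd n then (1 : ℂ) else 0) • b n) (n : ℕ) :
    PowerSeries.coeff n (expSeries (-currentMiwa)) (b 0) = b n := by
  refine coeff_expSeries_apply_eq (by rw [coeff_neg_currentMiwa]; simp)
    commute_coeff_neg_currentMiwa b (fun n => ?_) n
  -- The Euler factor `k` cancels the denominator of `2/k`.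
  have h1 : ∀ p ∈ Finset.HasAntidiagonal.antidiagonal n,
      (p.1 : ℂ) • PowerSeries.coeff p.1 (-currentMiwa) (b p.2) =
        (-2 : ℂ) • ((if Odd p.1 then (1 : ℂ) else 0) • c p.1 p.2 -
          (if Odd p.1 then (1 : ℂ) else 0) • b n) := fun p hp => by
    rw [coeff_neg_currentMiwa]
    split_ifs with h
    · have h0 : (p.1 : ℂ) ≠ 0 := Nat.cast_ne_zero.2 h.pos.ne'
      rw [LinearMap.smul_apply, hbc ⟨p.1, h⟩, smul_smul, mul_div_cancel₀ _ h0, one_smul, one_smul,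
        ← Finset.HasAntidiagonal.mem_antidiagonal.1 hp]
    · simp
  rw [Finset.sum_congr rfl h1, ← Finset.smul_sum, Finset.sum_sub_distrib, hc, ← Finset.sum_smul,
    smul_smul, ← sub_smul, smul_smul]
  congr 1
  linear_combination -two_mul_sum_odd_antidiagonal n

theorem coeff_expSeries_bra1 (n : ℕ) :
    PowerSeries.coeff n (expSeries (-currentMiwa)) (braPhi 0 bra0) = braPhi (-n) bra0 := by
  refine coeff_expSeries_neg_currentMiwa (fun n => braPhi (-n) bra0)
    (fun k n => braOf (PowerSeries.coeff k vacCurrent * phi (-n))) (fun k n => ?_) (fun n => ?_) n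
  · rw [braH_braPhi, braH_bra0, braPhi_braOf]
    congr 3
    push_cast; ring
  · have h := congrArg (fun F => braOfLin (PowerSeries.coeff n F)) vacCurrent_mul_phiMinus
    simp only [PowerSeries.coeff_smul, coeff_phiMinusOdd, map_smul, PowerSeries.coeff_mul,
      map_sum] at h
    change _ = _ • _ • braOf _ at h
    rw [braOf_phi] at h
    rw [← h]
    refine Finset.sum_congr rfl fun p _ => ?_
    split_ifs with hp
    · rw [one_smul, phiMinus, PowerSeries.coeff_mk]; rfl
    · rw [coeff_vacCurrent_of_even (Nat.not_odd_iff_even.1 hp), zero_mul, zero_mul, map_zero, zero_smul]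

/-- Writing `⟨0|` as `2⟨0|φ_0φ_0` makes it the initial member of the family `⟨0|φ_0φ_{-n}`. Compared
with `coeff_expSeries_bra1`, commuting `H_k` past `φ_0` adds the term `-⟨0|φ_{-k}φ_{-n}`. -/
theorem coeff_expSeries_bra0 (n : ℕ) :
    PowerSeries.coeff n (expSeries (-currentMiwa)) (braPhi 0 (braPhi 0 bra0)) =
      braPhi (-n) (braPhi 0 bra0) := by
  refine coeff_expSeries_neg_currentMiwa (fun n => braPhi (-n) (braPhi 0 bra0))
    (fun k n => braOf (PowerSeries.coeff k vacCurrent * (phi 0 * phi (-n)) -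
      phi (-k) * phi (-n))) (fun k n => ?_) (fun n => ?_) n
  · rw [braH_braPhi, braH_braPhi, braH_bra0, braPhi_braOf, map_sub, braPhi_braOf, zero_sub,
      ← braOf_phi (-(k : ℕ)), braPhi_braOf, mul_assoc]
    congr 3
    push_cast; ring
  · have h := congrArg (fun F => braOfLin (PowerSeries.coeff n F)) vacCurrent_mul_phi_zero_mul
    simp only [map_sub, PowerSeries.coeff_smul, PowerSeries.coeff_mul_C] at h
    rw [PowerSeries.coeff_mul, PowerSeries.coeff_mul] at h
    simp only [PowerSeries.coeff_C_mul, coeff_phiMinusOdd, map_smul, map_sum,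
      ← Finset.sum_sub_distrib, smul_mul_assoc] at h
    have h0 : braOfLin (phi (-n) * phi 0) = braPhi 0 (braPhi (-n) bra0) := by
      rw [← braOf_phi, braPhi_braOf]; rfl
    -- For odd `n` the modes `0` and `-n` anticommute, which accounts for the sign.
    have h2 : (1 / 2 : ℂ) • (if Odd n then (1 : ℂ) else 0) • braPhi (-n) (braPhi 0 bra0) =
        (-1 / 2 : ℂ) • (if Odd n then (1 : ℂ) else 0) • braPhi 0 (braPhi (-n) bra0) := by
      split_ifs with hn
      · have := hn.pos
        rw [braPhi_swap, if_neg (by omega)]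
        module
      · simp
    rw [h2, ← h0, ← h]
    refine Finset.sum_congr rfl fun p _ => ?_
    split_ifs with hp
    · rw [one_smul, one_smul, phiMinus, PowerSeries.coeff_mk]; rfl
    · rw [coeff_vacCurrent_of_even (Nat.not_odd_iff_even.1 hp), zero_mul, zero_mul, map_zero,
        zero_smul, zero_smul, sub_zero]

/-! ### The vacuum identities with their normalisation -/

theorem sqrt_two_mul_self : ((Real.sqrt 2 : ℝ) : ℂ) * ((Real.sqrt 2 : ℝ) : ℂ) = 2 := by
  rw [← Complex.ofReal_mul, Real.mul_self_sqrt (by norm_num)]; norm_num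

theorem bra1_eq : bra1 = ((Real.sqrt 2 : ℝ) : ℂ) • braPhi 0 bra0 := by
  rw [bra1, braOf_phi]

theorem braPhi_bra1 {n : ℤ} (hn : 0 < n) : braPhi n bra1 = 0 := by
  rw [bra1_eq, map_smul, braPhi_swap, if_neg (by omega), braPhi_bra0 hn]
  simp

theorem coeff_expSeries_neg_currentMiwa_bra1 (n : ℕ) :
    PowerSeries.coeff n (expSeries (-currentMiwa)) bra1 =
      ((Real.sqrt 2 : ℝ) : ℂ) • braPhi (-n) bra0 := by
  rw [bra1_eq, map_smul, coeff_expSeries_bra1]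

theorem coeff_expSeries_neg_currentMiwa_bra0 (n : ℕ) :
    PowerSeries.coeff n (expSeries (-currentMiwa)) bra0 =
      ((Real.sqrt 2 : ℝ) : ℂ) • braPhi (-n) bra1 := by
  have h := coeff_expSeries_bra0 n
  rw [braPhi_zero_braPhi_zero, map_smul] at h
  rw [bra1_eq, map_smul, smul_smul, sqrt_two_mul_self, ← h]
  module

theorem braExpMiwa_bra1 : braExpMiwa bra1 = ((Real.sqrt 2 : ℝ) : ℂ) • braPhiZ bra0 := by
  funext m
  rw [braExpMiwa, Pi.smul_apply, braPhiZ]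
  split_ifs with h
  · rw [coeff_expSeries_neg_currentMiwa_bra1, Int.toNat_of_nonneg (by omega), neg_neg]
  -- Positive powers of `z` are absent on both sides, since positive modes kill `⟨0|`.
  · rw [braPhi_bra0 (by omega), smul_zero]

theorem braExpMiwa_bra0 : braExpMiwa bra0 = ((Real.sqrt 2 : ℝ) : ℂ) • braPhiZ bra1 := by
  funext m
  rw [braExpMiwa, Pi.smul_apply, braPhiZ]
  split_ifs with h
  · rw [coeff_expSeries_neg_currentMiwa_bra0, Int.toNat_of_nonneg (by omega), neg_neg]
  · rw [braPhi_bra1 (by omega), smul_zero]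

/-! ### Correlation functions -/

theorem coeff_corr (u : FockL) (v : FockR) (n : OddPos →₀ ℕ) :
    MvPolynomial.coeff n (corr u v) =
      pairing u (MvPowerSeries.coeff n (expSeries currentPlus) v) := by
  classical
  change MvPolynomial.lcoeff ℂ n (∑ᶠ p, corrTerm u p v) = _
  rw [map_finsum _ (corrTerm_finite u v), finsum_eq_single _ n]
  · simp [corrTerm]
  · intro p hp
    simp [corrTerm, MvPolynomial.coeff_monomial, hp]

/-- `⟨U| ↦ ⟨U|e^{H_+(t)}|V⟩`. -/
def corrFlip (v : FockR) : FockL →ₗ[ℂ] MvPolynomial OddPos ℂ where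
  toFun u := corr u v
  map_add' u u' := by
    ext n
    simp only [MvPolynomial.coeff_add, coeff_corr, map_add, LinearMap.add_apply]
  map_smul' c u := by
    ext n
    simp only [MvPolynomial.coeff_smul, coeff_corr, map_smul, LinearMap.smul_apply,
      RingHom.id_apply]

theorem corrFlip_apply (u : FockL) (v : FockR) : corrFlip v u = corr u v := rfl

/-! ### Time derivatives of correlation functions -/

theorem coeff_zero_currentPlus : MvPowerSeries.coeff 0 currentPlus = 0 := by
  refine coeff_currentPlus_of_ne 0 ?_
  rintro ⟨k, hk⟩
  exact one_ne_zero (Finsupp.single_eq_zero.1 hk.symm)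

theorem commute_ketH_coeff_currentPlus (k : OddPos) (n : OddPos →₀ ℕ) :
    Commute (ketH k (oddPos_ne_zero k)) (MvPowerSeries.coeff n currentPlus) := by
  by_cases h : ∃ l : OddPos, n = Finsupp.single l 1
  · obtain ⟨l, rfl⟩ := h
    rw [coeff_currentPlus_single]
    exact commute_ketH k l
  · rw [coeff_currentPlus_of_ne n h]
    exact Commute.zero_right _

theorem commute_coeff_currentPlus (p q : OddPos →₀ ℕ) :
    Commute (MvPowerSeries.coeff p currentPlus) (MvPowerSeries.coeff q currentPlus) := by
  by_cases h : ∃ l : OddPos, p = Finsupp.single l 1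
  · obtain ⟨l, rfl⟩ := h
    rw [coeff_currentPlus_single]
    exact commute_ketH_coeff_currentPlus l q
  · rw [coeff_currentPlus_of_ne p h]
    exact Commute.zero_left _

theorem ketH_coeff_expSeries (k : OddPos) (n : OddPos →₀ ℕ) (v : FockR) :
    ketH k (oddPos_ne_zero k) (MvPowerSeries.coeff n (expSeries currentPlus) v) =
      MvPowerSeries.coeff n (expSeries currentPlus) (ketH k (oddPos_ne_zero k) v) :=
  LinearMap.congr_fun
    (commute_coeff_expSeries (commute_ketH_coeff_currentPlus k) n).eq v

/-- `∂_{t_k} e^{H_+(t)} = H_k e^{H_+(t)}`. -/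
theorem coeff_add_single_expSeries_currentPlus (k : OddPos) (n : OddPos →₀ ℕ) :
    ((n k + 1 : ℕ) : ℂ) • MvPowerSeries.coeff (n + Finsupp.single k 1) (expSeries currentPlus) =
      ketH k (oddPos_ne_zero k) * MvPowerSeries.coeff n (expSeries currentPlus) := by
  classical
  have h := congrArg (MvPowerSeries.coeff (n + Finsupp.single k 1))
    (coeffwise_weightMul_expSeries (Finsupp.applyAddHom k) coeff_zero_currentPlus
      commute_coeff_currentPlus)
  -- `H_+(t)` is linear in the times and the weight counts only `t_k`, so a single splitting
  -- contributes.
  rw [coeff_coeffwise, MvPowerSeries.coeff_mul,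
    Finset.sum_eq_single (Finsupp.single k 1, n)] at h
  · simpa [weightMul, coeff_coeffwise, coeff_currentPlus_single] using h
  · rintro ⟨p, q⟩ hpq hne
    by_cases hp : ∃ l : OddPos, p = Finsupp.single l 1
    · obtain ⟨l, rfl⟩ := hp
      have hl : l ≠ k := by
        rintro rfl
        have := Finset.HasAntidiagonal.mem_antidiagonal.1 hpq
        dsimp only at this
        rw [add_comm] at this
        exact hne (by rw [add_right_cancel this])
      simp [weightMul, coeff_coeffwise, hl]
    · simp [coeff_coeffwise, coeff_currentPlus_of_ne p hp]
  · intro hn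
    exact absurd (Finset.HasAntidiagonal.mem_antidiagonal.2 (add_comm _ _)) hn

theorem pderiv_corr (k : OddPos) (u : FockL) (v : FockR) :
    MvPolynomial.pderiv k (corr u v) = corr u (ketH k (oddPos_ne_zero k) v) := by
  ext n
  rw [MvPolynomial.coeff_pderiv, coeff_corr, coeff_corr, ← ketH_coeff_expSeries,
    ← Module.End.mul_apply, ← coeff_add_single_expSeries_currentPlus, LinearMap.smul_apply,
    map_smul, smul_eq_mul]
  push_cast
  ring

/-- `H_k` commutes with `e^{H_+(t)}`. Together with `pderiv_corr` this makes `∂_{t_k}` the action of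
`H_k` on the bra. -/
theorem corr_braH (k : OddPos) (u : FockL) (v : FockR) :
    corr (braH k (oddPos_ne_zero k) u) v = corr u (ketH k (oddPos_ne_zero k) v) := by
  ext n
  rw [coeff_corr, coeff_corr, pairing_braH, ketH_coeff_expSeries]

theorem coeff_zero_corr (u : FockL) (v : FockR) :
    MvPolynomial.coeff 0 (corr u v) = pairing u v := by
  rw [coeff_corr, coeff_zero_expSeries, Module.End.one_apply]

/-- `e^{H_+(t)}` never raises the degree, and `φ_n` then pushes it below zero. This makes the sums
over modes finite. -/
theorem corr_braPhi_eq_zero {d n : ℤ} {v : FockR} (hv : v ∈ ketFilt d) (hn : d + n < 0)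
    (u : FockL) : corr (braPhi n u) v = 0 := by
  ext p
  have h := ketPhi_mem n (lowers_coeff_expSeries ketFilt timeWt currentPlus
    lowers_currentPlus p d v hv)
  rw [ketFilt_neg (by omega), Submodule.mem_bot] at h
  rw [coeff_corr, pairing_braPhi, h, map_zero, MvPolynomial.coeff_zero]

/-- `ξ(t, z)` with coefficients in `ℂ[t_1, t_3, …]`. -/
def xiPoly : PowerSeries (MvPolynomial OddPos ℂ) :=
  PowerSeries.mk fun n => if h : Odd n then MvPolynomial.X ⟨n, h⟩ else 0

/-- The coefficient of `z^l` in `e^{ξ(t,z)}`. -/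
def expXi (l : ℕ) : MvPolynomial OddPos ℂ := PowerSeries.coeff l (expSeries xiPoly)

theorem mvCoeff_xiPoly_zero :
    MvPowerSeries.coeff 0 (xiPoly : MvPowerSeries Unit (MvPolynomial OddPos ℂ)) = 0 := by
  have : PowerSeries.coeff 0 xiPoly = 0 := by rw [xiPoly, PowerSeries.coeff_mk]; simp
  rw [← this]; exact congrArg (MvPowerSeries.coeff · xiPoly) (unit_finsupp_eq 0)

theorem expXi_zero : expXi 0 = 1 := by
  rw [expXi, ← coeff_zero_expSeries xiPoly]
  exact congrArg (MvPowerSeries.coeff · (expSeries xiPoly)) (unit_finsupp_eq 0).symm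

/-- At `t = 0` the series `ξ` vanishes and its exponential is `1`. -/
theorem coeff_zero_expXi {l : ℕ} (hl : l ≠ 0) : MvPolynomial.coeff 0 (expXi l) = 0 := by
  have h := map_coeff_expSeries (MvPolynomial.aeval (fun _ => (0 : ℂ)) :
    MvPolynomial OddPos ℂ →ₐ[ℂ] ℂ) xiPoly (Finsupp.single () l)
  have h0 : MvPowerSeries.map ((MvPolynomial.aeval (fun _ => (0 : ℂ)) :
      MvPolynomial OddPos ℂ →ₐ[ℂ] ℂ) : MvPolynomial OddPos ℂ →+* ℂ) xiPoly = 0 := by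
    refine MvPowerSeries.ext fun n => ?_
    rw [unit_finsupp_eq n, MvPowerSeries.coeff_map]
    change MvPolynomial.aeval _ (PowerSeries.coeff (n ()) xiPoly) = _
    rw [xiPoly, PowerSeries.coeff_mk]
    split_ifs <;> simp
  have h1 : PowerSeries.coeff l (expSeries (0 : MvPowerSeries Unit ℂ)) = 0 := by
    change ∑ m ∈ Finset.range ((Finsupp.single () l).degree + 1), ((m.factorial : ℂ)⁻¹) •
      MvPowerSeries.coeff (Finsupp.single () l) ((0 : MvPowerSeries Unit ℂ) ^ m) = 0
    refine Finset.sum_eq_zero fun m _ => ?_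
    rcases Nat.eq_zero_or_pos m with rfl | hm
    · have : PowerSeries.coeff l (1 : PowerSeries ℂ) = 0 := by
        rw [PowerSeries.coeff_one, if_neg hl]
      rw [pow_zero]
      exact (congrArg _ this).trans (smul_zero _)
    · rw [zero_pow hm.ne', map_zero, smul_zero]
  rw [h0] at h
  rw [← MvPolynomial.constantCoeff_eq]
  have h2 := h.trans h1
  have h3 : (MvPolynomial.aeval (fun _ => (0 : ℂ)) : MvPolynomial OddPos ℂ →ₐ[ℂ] ℂ) (expXi l) =
      MvPolynomial.constantCoeff (expXi l) := by
    simp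
  rw [← h3]; exact h2

theorem pderiv_xiPoly (k : OddPos) (n : ℕ) :
    MvPolynomial.pderiv k (PowerSeries.coeff n xiPoly) = if n = k then 1 else 0 := by
  classical
  rw [xiPoly, PowerSeries.coeff_mk]
  split_ifs with h h' h'
  · have : (⟨n, h⟩ : OddPos) = k := Subtype.ext h'
    rw [this, MvPolynomial.pderiv_X_self]
  · exact MvPolynomial.pderiv_X_of_ne fun h2 => h' (congrArg Subtype.val h2)
  · exact absurd (h' ▸ k.2) h
  · exact map_zero _

/-- Since `∂ξ/∂t_k = z^k`, differentiation multiplies `e^ξ` by `z^k`. -/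
theorem pderiv_expXi (k : OddPos) (l : ℕ) :
    MvPolynomial.pderiv k (expXi l) = if (k : ℕ) ≤ l then expXi (l - k) else 0 := by
  classical
  have h := coeffwise_expSeries (A := xiPoly)
    (T := fun _ : Unit →₀ ℕ => (MvPolynomial.pderiv (R := ℂ) k).toLinearMap)
    (fun _ _ _ _ => MvPolynomial.pderiv_mul) mvCoeff_xiPoly_zero (Commute.all _ _)
  have h1 : (coeffwise (fun _ : Unit →₀ ℕ => (MvPolynomial.pderiv (R := ℂ) k).toLinearMap)
      xiPoly : PowerSeries (MvPolynomial OddPos ℂ)) = PowerSeries.X ^ (k : ℕ) := by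
    ext1 n
    rw [PowerSeries.coeff_X_pow]
    exact pderiv_xiPoly k n
  rw [h1] at h
  have h2 := congrArg (PowerSeries.coeff l) h
  rw [PowerSeries.coeff_X_pow_mul'] at h2
  exact h2

/-- In characteristic zero, a coefficient of a nonconstant monomial is recovered from the derivative
in any variable that occurs in it. -/
theorem eq_of_pderiv_eq {f g : MvPolynomial OddPos ℂ}
    (h : ∀ k, MvPolynomial.pderiv k f = MvPolynomial.pderiv k g)
    (h0 : MvPolynomial.coeff 0 f = MvPolynomial.coeff 0 g) : f = g := by
  ext n
  by_cases hn : n = 0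
  · rw [hn, h0]
  obtain ⟨k, hk⟩ := Finsupp.ne_iff.1 hn
  have h1 : n - Finsupp.single k 1 + Finsupp.single k 1 = n :=
    tsub_add_cancel_of_le (Finsupp.single_le_iff.2 (Nat.one_le_iff_ne_zero.2 hk))
  have h2 := congrArg (MvPolynomial.coeff (n - Finsupp.single k 1)) (h k)
  rw [MvPolynomial.coeff_pderiv, MvPolynomial.coeff_pderiv, h1] at h2
  exact mul_right_cancel₀ (Nat.cast_add_one_ne_zero _) h2

/-- `⟨U|e^{H_+(t)}φ(z)|V⟩ = e^{ξ(t,z)}⟨U|φ(z)e^{H_+(t)}|V⟩`, coefficientwise. -/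
theorem corr_ketPhi (u : FockL) {d m : ℤ} {L : ℕ} {v : FockR} (hv : v ∈ ketFilt d)
    (hL : m + d < L) :
    corr u (ketPhi m v) = ∑ l ∈ Finset.range L, expXi l * corr (braPhi (m - l) u) v := by
  -- `N` drives the induction, while the length `L` of the sum stays free to vary.
  obtain ⟨N, hN⟩ : ∃ N : ℕ, m + d < N := ⟨L, hL⟩
  have hneg : ∀ {d m : ℤ} {L : ℕ} {v : FockR}, v ∈ ketFilt d → m + d < 0 →
      corr u (ketPhi m v) = ∑ l ∈ Finset.range L, expXi l * corr (braPhi (m - l) u) v := by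
    intro d m L v hv h
    have h1 := ketPhi_mem m hv
    rw [ketFilt_neg (by omega), Submodule.mem_bot] at h1
    rw [h1, map_zero]
    refine (Finset.sum_eq_zero fun l _ => ?_).symm
    rw [corr_braPhi_eq_zero hv (by omega), mul_zero]
  induction N generalizing d m L v with
  | zero => exact hneg hv (by exact_mod_cast hN)
  | succ N ih =>
    by_cases hmd : m + d < 0
    · exact hneg hv hmd
    -- The derivative brings in `H_k`, which either lowers the degree of the ket or turns `φ_m` into
    -- `φ_{m-k}`. Both decrease `m + d`, so the induction hypothesis applies to each term.
    refine eq_of_pderiv_eq (fun k => ?_) ?_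
    · have hk := k.2.pos
      have hkv := lowers_ketH k d v hv
      have e : corr u (ketH k (oddPos_ne_zero k) (ketPhi m v)) =
          corr u (ketPhi m (ketH k (oddPos_ne_zero k) v)) +
            corr u (ketPhi (m - (k : ℕ)) v) := by rw [ketH_ketPhi, map_add]
      rw [pderiv_corr, e, ih (L := L) hkv (by omega) (by push_cast at hN; omega),
        ih (L := L - k) hv (by omega) (by push_cast at hN; omega), map_sum]
      simp only [Derivation.leibniz, pderiv_corr, smul_eq_mul, pderiv_expXi,
        Finset.sum_add_distrib]
      congr 1
      -- The terms with `l < k` have zero derivative; the others are reindexed by `l - k`, matching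
      -- the mode `m - k`.
      rcases le_or_gt L (k : ℕ) with hLk | hLk
      · rw [Nat.sub_eq_zero_of_le hLk, Finset.range_zero, Finset.sum_empty]
        refine (Finset.sum_eq_zero fun l hl => ?_).symm
        rw [if_neg (by have := Finset.mem_range.1 hl; omega), mul_zero]
      · obtain ⟨r, rfl⟩ := Nat.exists_eq_add_of_lt hLk
        rw [show (k : ℕ) + r + 1 = k + (r + 1) by ring, Finset.sum_range_add,
          Nat.add_sub_cancel_left]
        rw [Finset.sum_eq_zero (s := Finset.range (k : ℕ)) fun l hl => by
          rw [if_neg (by have := Finset.mem_range.1 hl; omega), mul_zero], zero_add]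
        refine Finset.sum_congr rfl fun l _ => ?_
        rw [if_pos (by omega), Nat.add_sub_cancel_left, mul_comm, Nat.cast_add, sub_sub]
    · have h0 : ∀ f g : MvPolynomial OddPos ℂ, MvPolynomial.coeff 0 (f * g) =
          MvPolynomial.coeff 0 f * MvPolynomial.coeff 0 g := fun f g => by
        simp only [← MvPolynomial.constantCoeff_eq, map_mul]
      rw [MvPolynomial.coeff_sum, Finset.sum_eq_single 0]
      · rw [expXi_zero, one_mul, coeff_zero_corr, coeff_zero_corr, pairing_braPhi]
        simp
      · intro l _ hl
        rw [h0, coeff_zero_expXi hl, zero_mul]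
      · intro h
        exact absurd (Finset.mem_range.2 (by omega)) h

/-! ### The boson–fermion correspondence and the vertex operator -/

theorem bosonIncl_eq (f : MvPolynomial OddPos ℂ) :
    bosonIncl f = Ideal.Quotient.mk wIdeal (MvPolynomial.rename some f) := by
  have h : bosonIncl = (Ideal.Quotient.mkₐ ℂ wIdeal).comp (MvPolynomial.rename some) := by
    ext k
    simp [bosonIncl, bosonT]
  rw [h]; rfl

theorem bosonD_bosonIncl (k : OddPos) (f : MvPolynomial OddPos ℂ) :
    bosonD k (bosonIncl f) = bosonIncl (MvPolynomial.pderiv k f) := by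
  rw [bosonIncl_eq, bosonIncl_eq, bosonD_mk, MvPolynomial.pderiv_rename (Option.some_injective _)]

theorem bosonD_bosonW_mul (k : OddPos) (f : Boson) :
    bosonD k (bosonW * f) = bosonW * bosonD k f := by
  obtain ⟨p, rfl⟩ := Ideal.Quotient.mk_surjective f
  rw [bosonW, ← map_mul, bosonD_mk, bosonD_mk, MvPolynomial.pderiv_mul,
    MvPolynomial.pderiv_X_of_ne (by simp), zero_mul, zero_add, map_mul]

theorem bosonW_mul_self : bosonW * bosonW = 1 := by
  have h : Ideal.Quotient.mk wIdeal (MvPolynomial.X none ^ 2 - 1) = 0 :=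
    Ideal.Quotient.eq_zero_iff_mem.2 (Ideal.subset_span rfl)
  rw [map_sub, map_pow, map_one, sub_eq_zero, sq] at h
  exact h

theorem coeff_neg_xiDeriv (n : ℕ) :
    PowerSeries.coeff n (-xiDeriv) =
      if h : Odd n then (-2 / n : ℂ) • bosonD ⟨n, h⟩ else 0 := by
  rw [map_neg, xiDeriv, PowerSeries.coeff_mk]
  split_ifs
  · rw [neg_div]; exact (neg_smul _ _).symm
  · exact neg_zero

/-- `e^{-ξ(∂̃,u)}⟨U|e^{H_+(t)}|V⟩ = ⟨U|e^{-H_+[u]}e^{H_+(t)}|V⟩`. -/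
theorem coeff_expSeries_neg_xiDeriv_bosonIncl (j : ℕ) (u : FockL) (v : FockR) :
    PowerSeries.coeff j (expSeries (-xiDeriv)) (bosonIncl (corr u v)) =
      bosonIncl (corr (PowerSeries.coeff j (expSeries (-currentMiwa)) u) v) := by
  refine (intertwine_expSeries (bosonIncl.toLinearMap ∘ₗ corrFlip v) (A := -currentMiwa)
    (B := -xiDeriv) (fun n u => ?_) (Finsupp.single () j) u).symm
  rw [unit_finsupp_eq n]
  change bosonIncl (corrFlip v (PowerSeries.coeff (n ()) (-currentMiwa) u)) =
    PowerSeries.coeff (n ()) (-xiDeriv) (bosonIncl (corr u v))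
  rw [coeff_neg_xiDeriv, coeff_neg_currentMiwa]
  split_ifs with h
  · rw [LinearMap.smul_apply, LinearMap.smul_apply, map_smul, map_smul, bosonD_bosonIncl,
      pderiv_corr, corrFlip_apply, corr_braH ⟨n (), h⟩]
  · simp

theorem coeff_expSeries_neg_xiDeriv_bosonW_mul (j : ℕ) (f : Boson) :
    PowerSeries.coeff j (expSeries (-xiDeriv)) (bosonW * f) =
      bosonW * PowerSeries.coeff j (expSeries (-xiDeriv)) f := by
  refine (intertwine_expSeries (LinearMap.mulLeft ℂ bosonW) (A := -xiDeriv)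
    (B := -xiDeriv) (fun n f => ?_) (Finsupp.single () j) f).symm
  rw [unit_finsupp_eq n]
  change bosonW * PowerSeries.coeff (n ()) (-xiDeriv) f =
    PowerSeries.coeff (n ()) (-xiDeriv) (bosonW * f)
  rw [coeff_neg_xiDeriv]
  split_ifs with h
  · rw [LinearMap.smul_apply, LinearMap.smul_apply, bosonD_bosonW_mul, mul_smul_comm]
  · simp

theorem coeff_expSeries_xiTime (l : ℕ) :
    PowerSeries.coeff l (expSeries xiTime) = bosonIncl (expXi l) := by
  have h : MvPowerSeries.map (bosonIncl : MvPolynomial OddPos ℂ →+* Boson) xiPoly = xiTime := by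
    refine MvPowerSeries.ext fun n => ?_
    rw [unit_finsupp_eq n, MvPowerSeries.coeff_map]
    change bosonIncl (PowerSeries.coeff (n ()) xiPoly) = PowerSeries.coeff (n ()) xiTime
    rw [xiPoly, xiTime, PowerSeries.coeff_mk, PowerSeries.coeff_mk]
    split_ifs
    · simp [bosonIncl]
    · simp
  rw [← h]
  exact (map_coeff_expSeries bosonIncl xiPoly (Finsupp.single () l)).symm

theorem sigmaB_apply (v : FockR) :
    sigmaB v = bosonIncl (corr bra0 v) + bosonW * bosonIncl (corr bra1 v) := rfl

/-- The action of `e^{-ξ(∂̃,u)}` on the image of the correspondence. -/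
theorem bosonW_mul_coeff_expSeries_neg_xiDeriv_sigmaB (j : ℕ) (v : FockR) :
    bosonW * PowerSeries.coeff j (expSeries (-xiDeriv)) (sigmaB v) =
      ((Real.sqrt 2 : ℝ) : ℂ) • (bosonIncl (corr (braPhi (-j) bra0) v) +
        bosonW * bosonIncl (corr (braPhi (-j) bra1) v)) := by
  have h : ∀ (c : ℂ) u, corr (c • u) v = c • corr u v := fun c u => map_smul (corrFlip v) c u
  -- The exponential exchanges the two vacua, and `w` with `w² = 1` returns them to their own slots.
  rw [sigmaB_apply, map_add, coeff_expSeries_neg_xiDeriv_bosonW_mul,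
    coeff_expSeries_neg_xiDeriv_bosonIncl, coeff_expSeries_neg_xiDeriv_bosonIncl,
    coeff_expSeries_neg_currentMiwa_bra0, coeff_expSeries_neg_currentMiwa_bra1, h, h, map_smul,
    map_smul, mul_add, ← mul_assoc, bosonW_mul_self, one_mul, mul_smul_comm, smul_add, add_comm]

/-- The sum over nonpositive modes that the vertex operator produces. -/
theorem sum_bosonIncl_corr {u : FockL} (hu : ∀ n : ℤ, 0 < n → braPhi n u = 0) {d m : ℤ} {J : ℕ}
    {v : FockR} (hv : v ∈ ketFilt d) (hJ : d < J) :
    ∑ j ∈ Finset.range J, (if 0 ≤ m + j then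
      bosonIncl (expXi (m + j).toNat) * bosonIncl (corr (braPhi (-j) u) v) else 0) =
      bosonIncl (corr u (ketPhi m v)) := by
  have h0 : ∀ {n : ℤ}, 0 < n → corr (braPhi n u) v = 0 := fun hn => by
    rw [hu _ hn]; exact map_zero (corrFlip v)
  rw [corr_ketPhi u hv (show m + d < (m + J).toNat by omega), map_sum, ← Finset.sum_filter]
  -- The substitution is `l = m + j`. Indices `l < m` correspond to positive modes, which kill `u`.
  refine Finset.sum_bij_ne_zero (fun j _ _ => (m + j).toNat) ?_ ?_ ?_ ?_
  · intro j hj _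
    rw [Finset.mem_filter, Finset.mem_range] at hj
    rw [Finset.mem_range]; omega
  · intro a ha _ b hb _ h
    rw [Finset.mem_filter] at ha hb
    omega
  · intro l hl hne
    have hlm : m ≤ l := by
      by_contra hc
      exact hne (by rw [h0 (by omega), mul_zero, map_zero])
    rw [Finset.mem_range] at hl
    have hl' : (m + ((l - m).toNat : ℤ)).toNat = l := by omega
    refine ⟨(l - m).toNat, ?_, ?_, hl'⟩
    · rw [Finset.mem_filter, Finset.mem_range]; omega
    · rwa [hl', Int.toNat_of_nonneg (by omega), neg_sub, ← map_mul]
  · intro j hj _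
    rw [Finset.mem_filter] at hj
    rw [map_mul, Int.toNat_of_nonneg hj.2, sub_add_cancel_left]

/-- `σ_B(φ(z)|U⟩) = 2^{-1/2} w X_B(z) σ_B(|U⟩)`. -/
theorem sigmaB_ketPhi (m : ℤ) (v : FockR) :
    sigmaB (ketPhi m v) = ((Real.sqrt 2 : ℝ) : ℂ)⁻¹ • (bosonW * vertexB m (sigmaB v)) := by
  obtain ⟨d, hd⟩ := exists_mem_ketFilt v
  have hterm : ∀ j : ℕ, bosonW * vertexTerm m j (sigmaB v) = ((Real.sqrt 2 : ℝ) : ℂ) •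
      ((if 0 ≤ m + j then bosonIncl (expXi (m + j).toNat) *
          bosonIncl (corr (braPhi (-j) bra0) v) else 0) +
        bosonW * (if 0 ≤ m + j then bosonIncl (expXi (m + j).toNat) *
          bosonIncl (corr (braPhi (-j) bra1) v) else 0)) := fun j => by
    rw [vertexTerm]
    split_ifs
    · rw [LinearMap.comp_apply, LinearMap.mulLeft_apply, mul_left_comm,
        bosonW_mul_coeff_expSeries_neg_xiDeriv_sigmaB, coeff_expSeries_xiTime, mul_smul_comm,
        mul_add, mul_left_comm]
    · simp
  have hJ : d < (d + 1).toNat := by omega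
  -- For `j > d` the mode `-j` pushes a ket of degree at most `d` below zero.
  have hsupp : (Function.support fun j => bosonW * vertexTerm m j (sigmaB v)) ⊆
      (Finset.range (d + 1).toNat : Finset ℕ) := by
    intro j hj
    by_contra hc
    apply hj
    rw [Finset.mem_coe, Finset.mem_range] at hc
    have h := fun u => corr_braPhi_eq_zero (n := -(j : ℤ)) hd (by omega) u
    simp only [hterm, h]
    simp
  have hsum : bosonW * vertexB m (sigmaB v) =
      ∑ j ∈ Finset.range (d + 1).toNat, bosonW * vertexTerm m j (sigmaB v) := by
    change LinearMap.mulLeft ℂ bosonW (∑ᶠ j, vertexTerm m j (sigmaB v)) = _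
    rw [map_finsum _ (vertexTerm_finite m _)]
    exact finsum_eq_sum_of_support_subset _ hsupp
  have h2 : ((Real.sqrt 2 : ℝ) : ℂ) ≠ 0 :=
    left_ne_zero_of_mul (sqrt_two_mul_self.trans_ne two_ne_zero)
  rw [hsum, Finset.sum_congr rfl fun j _ => hterm j, ← Finset.smul_sum, smul_smul,
    inv_mul_cancel₀ h2, one_smul, Finset.sum_add_distrib, ← Finset.mul_sum,
    sum_bosonIncl_corr (fun n hn => braPhi_bra0 hn) hd hJ,
    sum_bosonIncl_corr (fun n hn => braPhi_bra1 hn) hd hJ, sigmaB_apply]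

end

end BInf

theorem mainTheorem7 :
    (∀ v : FockR, (fun m => sigmaB (phiKet v m) : ZSeries Boson) =
      fun m => ((Real.sqrt 2 : ℝ) : ℂ)⁻¹ • (bosonW * vertexZ (sigmaB v) m)) ∧
    (braExpMiwa bra1 = ((Real.sqrt 2 : ℝ) : ℂ) • braPhiZ bra0) ∧
    (braExpMiwa bra0 = ((Real.sqrt 2 : ℝ) : ℂ) • braPhiZ bra1) :=
  ⟨fun v => funext fun m => sigmaB_ketPhi m v, braExpMiwa_bra1, braExpMiwa_bra0⟩
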